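/- Let $N\ge 0$ and let $X\subset\mathbb{P}^N$ be a cubic hypersurface over $\mathbb{C}$, i.e. $X=(F=0)$ for an irreducible homogeneous polynomial $F\in\mathbb{C}[x_0,\dots,x_N]$ of degree $3$. Let $\operatorname{Sing}(X)$ be its singular locus, let $X^*\subset(\mathbb{P}^N)^\vee$ be its dual variety, i.e. the Zariski closure of the set of hyperplanes tangent to $X$ at some smooth point of $X$, and let $\delta_X:=N-1-\dim X^*$ be its dual defect. Assume that $X$ is not a cone (there is no point $v\in X$ such that for every $x\in X\setminus\{v\}$ the line joining $v$ and $x$ is contained in $X$) and that $\dim\operatorname{Sing}(X)=N-2$, where $\dim\emptyset=-1$. Then $\delta_X>0$ if and only if $(N,\delta_X)=(4,1)$ and $X$ is projectively equivalent to the hypersurface $(x_0x_1x_2+x_0^2x_4+x_1^2x_3=0)\subset\mathbb{P}^4$. Moreover, in this case, $\operatorname{Sing}(X)$ is a $2$-plane, i.e. a $2$-dimensional linear subvariety of $\mathbb{P}^4$. -/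

import Mathlib

open scoped LinearAlgebra.Projectivization

namespace ProjGeom

/-- Complex projective space of dimension `N`, with homogeneous coordinates `x 0, …, x N`.
The dual projective space is identified with it through the coefficients of linear forms. -/
abbrev PN (N : ℕ) : Type := ℙ ℂ (Fin (N + 1) → ℂ)

/-- The homogeneous coordinate ring of projective `N`-space. -/
abbrev CoordRing (N : ℕ) : Type := MvPolynomial (Fin (N + 1)) ℂ

/-- The zero set in projective space of a homogeneous polynomial (for homogeneous `F` the
condition does not depend on the representative of `p`). -/
def zeroSet {N : ℕ} (F : CoordRing N) : Set (PN N) :=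
  {p | MvPolynomial.eval p.rep F = 0}

/-- The (pointed) affine cone over a set of points of projective space:
all nonzero vectors that represent a point of the set. -/
def affineCone {N : ℕ} (V : Set (PN N)) : Set (Fin (N + 1) → ℂ) :=
  {v | ∃ hv : v ≠ 0, Projectivization.mk ℂ v hv ∈ V}

/-- The homogeneous ideal `I(V)` of a set `V` of points of projective space. -/
noncomputable def homogeneousIdeal {N : ℕ} (V : Set (PN N)) : Ideal (CoordRing N) :=
  MvPolynomial.vanishingIdeal ℂ (affineCone V)

/-- The Zariski closure of a set of points of projective space. -/
def zariskiClosure {N : ℕ} (V : Set (PN N)) : Set (PN N) :=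
  {p | ∀ f ∈ homogeneousIdeal V, MvPolynomial.eval p.rep f = 0}

/-- The dimension of a Zariski closed subset `V` of projective space: the Krull dimension of its
homogeneous coordinate ring `ℂ[x] / I(V)`, minus one; the empty set (zero ring, Krull dimension
`⊥`) has dimension `-1`. -/
noncomputable def projDim {N : ℕ} (V : Set (PN N)) : ℤ :=
  (((ringKrullDim (CoordRing N ⧸ homogeneousIdeal V)).unbotD 0).toNat : ℤ) - 1

/-- The linear subvariety of projective space given by a linear subspace `W` of `ℂ ^ (N + 1)`. -/
def linearVariety {N : ℕ} (W : Submodule ℂ (Fin (N + 1) → ℂ)) : Set (PN N) :=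
  {p | p.submodule ≤ W}

/-- `V` is an `r`-plane, that is, an `r`-dimensional linear subvariety. -/
def IsPlane {N : ℕ} (r : ℕ) (V : Set (PN N)) : Prop :=
  ∃ W : Submodule ℂ (Fin (N + 1) → ℂ), Module.finrank ℂ W = r + 1 ∧ V = linearVariety W

/-- The linear variety spanned by two points (a line if the points are distinct). -/
def lineThrough {N : ℕ} (x y : PN N) : Set (PN N) :=
  linearVariety (x.submodule ⊔ y.submodule)

/-- `X` is a cone: there is a vertex `v ∈ X` such that `X` contains the line joining `v` to
any point of `X`. -/
def IsCone {N : ℕ} (X : Set (PN N)) : Prop :=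
  ∃ v ∈ X, ∀ x ∈ X, lineThrough v x ⊆ X

/-- Two subsets of projective spaces are projectively equivalent if a projective linear
isomorphism carries one onto the other. -/
def ProjEquivalent {N M : ℕ} (X : Set (PN N)) (Y : Set (PN M)) : Prop :=
  ∃ e : (Fin (N + 1) → ℂ) ≃ₗ[ℂ] (Fin (M + 1) → ℂ),
    Projectivization.map e.toLinearMap e.injective '' X = Y

/-- The singular locus of the hypersurface `F = 0`, for `F` homogeneous and irreducible: the
points of the hypersurface where all partial derivatives of `F` vanish. -/
def singularLocus {N : ℕ} (F : CoordRing N) : Set (PN N) :=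
  {p | p ∈ zeroSet F ∧ ∀ i, MvPolynomial.eval p.rep (MvPolynomial.pderiv i F) = 0}

/-- The embedded tangent space at `p` of the hypersurface `F = 0`, for `F` homogeneous and
irreducible. -/
def tangentSpace {N : ℕ} (F : CoordRing N) (p : PN N) : Set (PN N) :=
  {y | ∑ i, MvPolynomial.eval p.rep (MvPolynomial.pderiv i F) * y.rep i = 0}

/-- The hyperplane with coefficients `h`, for a point `h` of the dual projective space. -/
def hyperplane {N : ℕ} (h : PN N) : Set (PN N) :=
  {y | ∑ i, h.rep i * y.rep i = 0}

/-- The dual variety of the hypersurface `F = 0`, for `F` homogeneous and irreducible: the Zariski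
closure, in the dual projective space, of the set of hyperplanes which are tangent to the
hypersurface at some smooth point. -/
def dualVariety {N : ℕ} (F : CoordRing N) : Set (PN N) :=
  zariskiClosure {h | ∃ p ∈ zeroSet F, p ∉ singularLocus F ∧ tangentSpace F p ⊆ hyperplane h}

/-- The dual defect `N - 1 - dim X*` of the hypersurface `X = (F = 0)`. -/
noncomputable def dualDefect {N : ℕ} (F : CoordRing N) : ℤ :=
  (N : ℤ) - 1 - projDim (dualVariety F)

/-- The cubic form `x₀ x₁ x₂ + x₀² x₄ + x₁² x₃` in the coordinates of projective `4`-space. -/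
noncomputable def perazzoCubic : CoordRing 4 :=
  MvPolynomial.X 0 * MvPolynomial.X 1 * MvPolynomial.X 2
    + MvPolynomial.X 0 ^ 2 * MvPolynomial.X 4 + MvPolynomial.X 1 ^ 2 * MvPolynomial.X 3

end ProjGeom

/-!
Let `T` be the polar form of `F`, the symmetric trilinear form with `F v = T v v v`; the singular
points of the hypersurface `X` are the zeros of `v ↦ T v v`, and a nonzero vector `z` with `T z = 0`
is a vertex of `X` (`IsPolarForm.isCone`).

The `(N - 2)`-dimensional part of the singular locus is linear
(`exists_linear_singular_subspace`). Indeed, let `P` be the prime ideal of a component of that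
dimension and `z` a point of it. A line through two singular points of a cubic lies in the cubic,
so the join of the component with `z` is an irreducible subvariety of `X`. If it is larger than the
component, then it is `X` for reasons of dimension, and `X` is a cone with vertex `z`. Hence
`V(P)` is stable under joins, that is, linear (`joinIdeal_eq`). This gives a subspace `W` of
codimension two with `T w w' = 0` on `W`, and in coordinates adapted to `W` the form is
`F = x₀² A + x₀ x₁ B + x₁² C` with linear forms `A`, `B`, `C`.

A vector `w` of `W` is determined by `T e₀ e₀ w`, `T e₀ e₁ w`, `T e₁ e₁ w`, where `e₀`, `e₁` span a
complement: otherwise `X` would be a cone (`IsPolarForm.pairing_injective`). So `dim W ≤ 3` and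
`N ≤ 4`. For `N = 4` the three functionals are coordinates on `W`, which gives the Perazzo cubic
and shows that the singular locus is `W` (`perazzo_of_dim_four`). For `N = 3` and `N = 2`, the space
of binary quadratic forms `T · · w` has, up to coordinates, one of two shapes, and `F` is one of four
explicit cubics, all of dual defect zero; `N ≤ 1` does not occur.

The ideal of the dual variety consists of the polynomials vanishing at the gradients of `F` at the
smooth points (`mem_homogeneousIdeal_dualVariety`). The dimension of the dual variety is bounded from
below by a chain of primes: the kernels of a parametrisation by gradients and of its successive
specialisations (`succ_le_ringKrullDim_quotient_ker`). For the Perazzo cubic, it is bounded from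
above by a chain of primes below the ideal, since the dual variety lies on a rational normal scroll
(`ringKrullDim_dualVariety_perazzoCubic_le`).
-/

namespace ProjGeom

open MvPolynomial

/-! ### The polar form of a cubic -/

/-- `T` is the polar form of the cubic form `F`: the symmetric trilinear form with
`F v = T v v v`, so that the differential of `F` at `v` is `3 * T v v`. -/
structure IsPolarForm {N : ℕ} (F : CoordRing N)
    (T : (Fin (N + 1) → ℂ) →ₗ[ℂ] (Fin (N + 1) → ℂ) →ₗ[ℂ] (Fin (N + 1) → ℂ) →ₗ[ℂ] ℂ) : Prop where
  swap₁₂ : ∀ x y z, T x y z = T y x z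
  swap₂₃ : ∀ x y z, T x y z = T x z y
  eval_eq : ∀ v, eval v F = T v v v
  sum_pderiv : ∀ v w, ∑ i, eval v (pderiv i F) * w i = 3 * T v v w

lemma eval_euler {N n : ℕ} {F : CoordRing N} (hF : F.IsHomogeneous n) (v : Fin (N + 1) → ℂ) :
    ∑ i, v i * eval v (pderiv i F) = n * eval v F := by
  have := congrArg (eval v) hF.sum_X_mul_pderiv
  simpa [map_sum] using this

/-- Euler's identity, applied three times, expresses a cubic form through its third partial
derivatives, which are constants. -/
lemma exists_isPolarForm {N : ℕ} {F : CoordRing N} (hF : F.IsHomogeneous 3) :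
    ∃ T, IsPolarForm F T := by
  set c : Fin (N + 1) → Fin (N + 1) → Fin (N + 1) → ℂ :=
    fun i j k => eval 0 (pderiv k (pderiv j (pderiv i F))) with hc
  have hcomm : ∀ (i j : Fin (N + 1)) (G : CoordRing N),
      pderiv i (pderiv j G) = pderiv j (pderiv i G) := fun i j G => by
    have : ⁅(pderiv i : Derivation ℂ (CoordRing N) (CoordRing N)),
        (pderiv j : Derivation ℂ (CoordRing N) (CoordRing N))⁆ = 0 := by
      apply MvPolynomial.derivation_ext
      intro k
      simp [Derivation.commutator_apply, pderiv_X, Pi.single_apply]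
      split_ifs <;> simp
    have h2 := congrArg (fun D : Derivation ℂ (CoordRing N) (CoordRing N) => D G) this
    simpa [Derivation.commutator_apply, sub_eq_zero] using h2
  have h1 : ∀ i, (pderiv i F).IsHomogeneous 2 := fun i => hF.pderiv
  have h2 : ∀ i j, (pderiv j (pderiv i F)).IsHomogeneous 1 := fun i j => (h1 i).pderiv
  have h3 : ∀ i j k, (pderiv k (pderiv j (pderiv i F))).IsHomogeneous 0 :=
    fun i j k => (h2 i j).pderiv
  have hcv : ∀ i j k v, eval v (pderiv k (pderiv j (pderiv i F))) = c i j k := by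
    intro i j k v
    have := (totalDegree_zero_iff_isHomogeneous _).2 (h3 i j k)
    rw [totalDegree_eq_zero_iff_eq_C] at this
    simp only [hc]
    rw [this, eval_C, eval_C]
  have e1 : ∀ i j v, eval v (pderiv j (pderiv i F)) = ∑ k, v k * c i j k := by
    intro i j v
    have := eval_euler (h2 i j) v
    simp only [hcv] at this
    simp [this]
  have e2 : ∀ i v, eval v (pderiv i F) = (∑ j, v j * ∑ k, v k * c i j k) / 2 := by
    intro i v
    have := eval_euler (h1 i) v
    simp only [e1] at this
    rw [this]; simp
  have e3 : ∀ v, eval v F = (∑ i, v i * ((∑ j, v j * ∑ k, v k * c i j k) / 2)) / 3 := by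
    intro v
    have := eval_euler hF v
    simp only [e2] at this
    rw [this]; simp
  have s12 : ∀ i j k, c i j k = c j i k := fun i j k => by simp only [hc]; rw [hcomm j i]
  have s23 : ∀ i j k, c i j k = c i k j := fun i j k => by simp only [hc]; rw [hcomm k j]
  let T : (Fin (N + 1) → ℂ) →ₗ[ℂ] (Fin (N + 1) → ℂ) →ₗ[ℂ] (Fin (N + 1) → ℂ) →ₗ[ℂ] ℂ :=
    ∑ i, (LinearMap.proj i).smulRight
      (∑ j, (LinearMap.proj j).smulRight (∑ k, (c i j k / 6) • LinearMap.proj k))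
  have hT : ∀ x y z, T x y z = ∑ i, x i * ∑ j, y j * ∑ k, c i j k / 6 * z k := by
    intro x y z
    simp [T, LinearMap.sum_apply, LinearMap.smulRight_apply, LinearMap.smul_apply]
  have t12 : ∀ x y z, T x y z = T y x z := by
    intro x y z
    rw [hT, hT]
    simp only [Finset.mul_sum]
    rw [Finset.sum_comm]
    refine Finset.sum_congr rfl fun i _ => Finset.sum_congr rfl fun j _ =>
      Finset.sum_congr rfl fun k _ => ?_
    rw [s12]; ring
  have t23 : ∀ x y z, T x y z = T x z y := by
    intro x y z
    rw [hT, hT]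
    refine Finset.sum_congr rfl fun i _ => ?_
    simp only [Finset.mul_sum]
    rw [Finset.sum_comm]
    refine Finset.sum_congr rfl fun j _ => Finset.sum_congr rfl fun k _ => ?_
    rw [s23]; ring
  refine ⟨T, t12, t23, ?_, ?_⟩
  · intro v
    rw [hT, e3]
    simp only [Finset.mul_sum, Finset.sum_div]
    refine Finset.sum_congr rfl fun i _ => Finset.sum_congr rfl fun j _ =>
      Finset.sum_congr rfl fun k _ => ?_
    ring
  · intro v w
    rw [t23, t12, hT]
    simp only [e2, Finset.mul_sum, Finset.sum_div, Finset.sum_mul]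
    refine Finset.sum_congr rfl fun i _ => Finset.sum_congr rfl fun j _ =>
      Finset.sum_congr rfl fun k _ => ?_
    ring

/-- The gradient of `F` at `v`. -/
noncomputable def grad {N : ℕ} (F : CoordRing N) (v : Fin (N + 1) → ℂ) : Fin (N + 1) → ℂ :=
  fun i => eval v (pderiv i F)

lemma eval_smul_of_isHomogeneous {N n : ℕ} {F : CoordRing N} (hF : F.IsHomogeneous n) (c : ℂ)
    (v : Fin (N + 1) → ℂ) : eval (c • v) F = c ^ n * eval v F := by
  rw [eval_eq, eval_eq, Finset.mul_sum]
  refine Finset.sum_congr rfl fun d hd => ?_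
  have hdeg : ∑ i ∈ d.support, d i = n := by
    have := hF (mem_support_iff.1 hd)
    rwa [Finsupp.weight_apply, Finsupp.sum, Finset.sum_congr rfl] at this
    intro i _; simp
  simp only [Pi.smul_apply, smul_eq_mul, mul_pow, Finset.prod_mul_distrib,
    Finset.prod_pow_eq_pow_sum, hdeg]
  ring

lemma mk_mem_zeroSet {N n : ℕ} {F : CoordRing N} (hF : F.IsHomogeneous n)
    {v : Fin (N + 1) → ℂ} (hv : v ≠ 0) :
    Projectivization.mk ℂ v hv ∈ zeroSet F ↔ eval v F = 0 := by
  obtain ⟨a, ha⟩ := Projectivization.exists_smul_eq_mk_rep ℂ v hv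
  rw [zeroSet, Set.mem_ofPred_eq, ← ha, Units.smul_def, eval_smul_of_isHomogeneous hF]
  simp

lemma grad_smul {N n : ℕ} {F : CoordRing N} (hF : F.IsHomogeneous (n + 1)) (c : ℂ)
    (v : Fin (N + 1) → ℂ) : grad F (c • v) = c ^ n • grad F v := by
  ext i
  simpa [grad] using eval_smul_of_isHomogeneous (hF.pderiv (i := i)) c v

lemma IsPolarForm.grad_eq_zero_iff {N : ℕ} {F : CoordRing N} {T} (hT : IsPolarForm F T)
    (v : Fin (N + 1) → ℂ) : grad F v = 0 ↔ T v v = 0 := by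
  constructor
  · intro h
    ext w
    have := hT.sum_pderiv v (Pi.single w 1)
    have h2 : ∀ i, eval v (pderiv i F) = 0 := fun i => congrFun h i
    simpa [h2] using this.symm
  · intro h
    ext i
    have := hT.sum_pderiv v (Pi.single i 1)
    simpa [h, Pi.single_apply, grad] using this

/-- The affine cone over the singular locus consists of the nonzero zeros of the gradient: by
Euler's identity these lie on the hypersurface. -/
lemma IsPolarForm.mk_mem_singularLocus {N : ℕ} {F : CoordRing N} (hF : F.IsHomogeneous 3)
    {T} (hT : IsPolarForm F T) {v : Fin (N + 1) → ℂ} (hv : v ≠ 0) :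
    Projectivization.mk ℂ v hv ∈ singularLocus F ↔ T v v = 0 := by
  rw [← hT.grad_eq_zero_iff]
  obtain ⟨a, ha⟩ := Projectivization.exists_smul_eq_mk_rep ℂ v hv
  rw [singularLocus, Set.mem_ofPred_eq, mk_mem_zeroSet hF, ← ha, Units.smul_def]
  have hg : (∀ i, eval ((a : ℂ) • v) (pderiv i F) = 0) ↔ grad F v = 0 := by
    have h1 : (∀ i, eval ((a : ℂ) • v) (pderiv i F) = 0) ↔ grad F ((a : ℂ) • v) = 0 :=
      ⟨fun h => funext h, fun h i => congrFun h i⟩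
    rw [h1, grad_smul hF]
    simp
  rw [hg, and_iff_right_iff_imp]
  intro h
  rw [hT.eval_eq, (hT.grad_eq_zero_iff v).1 h]
  simp

/-- A vector in the radical of the polar form is the vertex of a cone. -/
lemma IsPolarForm.isCone {N : ℕ} {F : CoordRing N} (hF : F.IsHomogeneous 3)
    {T} (hT : IsPolarForm F T) {z : Fin (N + 1) → ℂ} (hz : z ≠ 0) (h : T z = 0) :
    IsCone (zeroSet F) := by
  have h2 : ∀ x, T x z = 0 := fun x => by
    refine LinearMap.ext fun y => ?_
    rw [hT.swap₁₂, h]; simp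
  have h3 : ∀ x y, T x y z = 0 := fun x y => by rw [hT.swap₂₃, h2]; simp
  refine ⟨Projectivization.mk ℂ z hz, ?_, ?_⟩
  · rw [mk_mem_zeroSet hF, hT.eval_eq, h]; simp
  · intro x hx y hy
    have hy' : y.rep ∈ (Projectivization.mk ℂ z hz).submodule ⊔ x.submodule :=
      hy (by rw [Projectivization.submodule_eq]; exact Submodule.mem_span_singleton_self _)
    rw [Projectivization.submodule_mk, Projectivization.submodule_eq,
      Submodule.mem_sup] at hy'
    obtain ⟨p, hp, q, hq, hpq⟩ := hy'
    obtain ⟨a, rfl⟩ := Submodule.mem_span_singleton.1 hp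
    obtain ⟨b, rfl⟩ := Submodule.mem_span_singleton.1 hq
    have hx0 : T x.rep x.rep x.rep = 0 := by rw [← hT.eval_eq]; exact hx
    change eval y.rep F = 0
    rw [hT.eval_eq, ← hpq]
    simp [h, h2, h3, hx0]

/-! ### The ideal of the dual variety -/

lemma homogeneousIdeal_zariskiClosure {N : ℕ} (V : Set (PN N)) :
    homogeneousIdeal (zariskiClosure V) = homogeneousIdeal V := by
  apply le_antisymm
  · apply vanishingIdeal_anti_mono
    rintro v ⟨hv, hmem⟩
    refine ⟨hv, fun f hf => ?_⟩
    have := hf (Projectivization.mk ℂ v hv).rep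
      ⟨Projectivization.rep_nonzero _, by rwa [Projectivization.mk_rep]⟩
    simpa using this
  · rintro f hf v ⟨hv, hmem⟩
    obtain ⟨a, ha⟩ := Projectivization.exists_smul_eq_mk_rep ℂ v hv
    -- the rescaling `f (a⁻¹ x)` of `f` also vanishes on the affine cone over `V`
    have hg : aeval (fun i => C ((a⁻¹ : ℂˣ) : ℂ) * X i) f ∈ homogeneousIdeal V := by
      rintro w ⟨hw, hwV⟩
      have h1 : ((a⁻¹ : ℂˣ) : ℂ) • w ≠ 0 := by simpa using hw
      have h2 := hf (((a⁻¹ : ℂˣ) : ℂ) • w) ⟨h1, by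
        rwa [(Projectivization.mk_eq_mk_iff ℂ _ _ h1 hw).2 ⟨a⁻¹, rfl⟩]⟩
      rw [← AlgHom.comp_apply, comp_aeval]
      convert h2 using 2
      simp [Pi.smul_def]
    have h3 := hmem _ hg
    rw [← coe_aeval_eq_eval, RingHom.coe_coe, ← AlgHom.comp_apply, comp_aeval, ← ha] at h3
    convert h3 using 2
    congr 1
    ext i
    simp [Units.smul_def]

lemma tangentSpace_subset_hyperplane_iff {N : ℕ} {F : CoordRing N} {p h : PN N}
    (hp : grad F p.rep ≠ 0) :
    tangentSpace F p ⊆ hyperplane h ↔ ∃ c : ℂ, h.rep = c • grad F p.rep := by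
  constructor
  · intro hsub
    have key : ∀ w : Fin (N + 1) → ℂ, ∑ i, grad F p.rep i * w i = 0 →
        ∑ i, h.rep i * w i = 0 := by
      intro w hw
      by_cases hw0 : w = 0
      · simp [hw0]
      obtain ⟨a, ha⟩ := Projectivization.exists_smul_eq_mk_rep ℂ w hw0
      have h1 : Projectivization.mk ℂ w hw0 ∈ tangentSpace F p := by
        change ∑ i, grad F p.rep i * (Projectivization.mk ℂ w hw0).rep i = 0
        rw [← ha]
        simp only [Units.smul_def, Pi.smul_apply, smul_eq_mul, mul_left_comm _ (a : ℂ),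
          ← Finset.mul_sum, hw, mul_zero]
      have h2 : ∑ i, h.rep i * (Projectivization.mk ℂ w hw0).rep i = 0 := hsub h1
      rw [← ha] at h2
      simpa only [Units.smul_def, Pi.smul_apply, smul_eq_mul, mul_left_comm _ (a : ℂ),
        ← Finset.mul_sum, mul_eq_zero, a.ne_zero, false_or] using h2
    obtain ⟨k, hk⟩ := Function.ne_iff.1 hp
    refine ⟨h.rep k / grad F p.rep k, ?_⟩
    ext i
    have := key (Pi.single i (grad F p.rep k) - Pi.single k (grad F p.rep i)) (by
      simp [mul_sub, Finset.sum_sub_distrib, Pi.single_apply]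
      ring)
    simp [mul_sub, Finset.sum_sub_distrib, Pi.single_apply] at this
    have hk' : grad F p.rep k ≠ 0 := hk
    simp only [Pi.smul_apply, smul_eq_mul]
    field_simp
    linear_combination this
  · rintro ⟨c, hc⟩ y hy
    change ∑ i, h.rep i * y.rep i = 0
    have hy' : ∑ i, grad F p.rep i * y.rep i = 0 := hy
    simp only [hc, Pi.smul_apply, smul_eq_mul, mul_assoc, ← Finset.mul_sum, hy', mul_zero]

/-- The ideal of the dual variety consists of the polynomials which vanish at the gradients of
`F` at all smooth points of the hypersurface. -/
lemma mem_homogeneousIdeal_dualVariety {N : ℕ} {F : CoordRing N} (hF : F.IsHomogeneous 3)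
    (g : CoordRing N) :
    g ∈ homogeneousIdeal (dualVariety F) ↔
      ∀ v, eval v F = 0 → grad F v ≠ 0 → eval (grad F v) g = 0 := by
  rw [dualVariety, homogeneousIdeal_zariskiClosure]
  have hsing : ∀ p : PN N, p ∈ zeroSet F → p ∉ singularLocus F → grad F p.rep ≠ 0 :=
    fun p hp hps h0 => hps ⟨hp, fun i => congrFun h0 i⟩
  constructor
  · intro hg v hv hgv
    have hv0 : v ≠ 0 := by
      rintro rfl
      apply hgv
      have := grad_smul hF 0 0
      simpa using this
    obtain ⟨a, ha⟩ := Projectivization.exists_smul_eq_mk_rep ℂ v hv0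
    obtain ⟨b, hb⟩ := Projectivization.exists_smul_eq_mk_rep ℂ (grad F v) hgv
    have hga : grad F (Projectivization.mk ℂ v hv0).rep = (a : ℂ) ^ 2 • grad F v := by
      rw [← ha, Units.smul_def, grad_smul hF]
    have hga0 : grad F (Projectivization.mk ℂ v hv0).rep ≠ 0 := by
      rw [hga]; simpa using hgv
    have := hg (grad F v) ⟨hgv, Projectivization.mk ℂ v hv0, (mk_mem_zeroSet hF hv0).2 hv,
      fun h => hga0 (funext h.2), (tangentSpace_subset_hyperplane_iff hga0).2
        ⟨b / (a : ℂ) ^ 2, by rw [← hb, hga, smul_smul, Units.smul_def]; simp⟩⟩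
    simpa using this
  · rintro h v ⟨hv, p, hp, hps, hsub⟩
    have hgp := hsing p hp hps
    obtain ⟨c, hc⟩ := (tangentSpace_subset_hyperplane_iff hgp).1 hsub
    obtain ⟨a, ha⟩ := Projectivization.exists_smul_eq_mk_rep ℂ v hv
    -- the gradient is homogeneous of degree two, so every multiple of it is again a gradient
    obtain ⟨s, hs⟩ := IsAlgClosed.exists_pow_nat_eq (c / a) (n := 2) (by norm_num)
    have hvs : v = grad F (s • p.rep) := by
      rw [grad_smul hF, hs, div_eq_inv_mul, mul_smul, ← hc, ← ha, Units.smul_def, smul_smul]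
      simp
    have := h (s • p.rep) (by
      rw [eval_smul_of_isHomogeneous hF, show eval p.rep F = 0 from hp, mul_zero]) (hvs ▸ hv)
    rw [← hvs] at this
    simpa using this

/-! ### Krull dimension and chains of primes -/

lemma length_le_ringKrullDim_quotient {R : Type*} [CommRing R] {I : Ideal R}
    (l : LTSeries (PrimeSpectrum R)) (h : I ≤ l.head.asIdeal) :
    (l.length : WithBot ℕ∞) ≤ ringKrullDim (R ⧸ I) := by
  rw [ringKrullDim_quotient, Order.le_krullDim_iff]
  refine ⟨⟨l.length, fun i => ⟨l i, ?_⟩, fun i => l.step i⟩, rfl⟩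
  exact h.trans (LTSeries.head_le l i)

lemma exists_ltSeries_of_le_ringKrullDim_quotient {R : Type*} [CommRing R] {I : Ideal R} {n : ℕ}
    (h : (n : WithBot ℕ∞) ≤ ringKrullDim (R ⧸ I)) :
    ∃ l : LTSeries (PrimeSpectrum R), I ≤ l.head.asIdeal ∧ l.length = n := by
  rw [ringKrullDim_quotient, Order.le_krullDim_iff] at h
  obtain ⟨l, hl⟩ := h
  refine ⟨⟨l.length, fun i => (l i).1, fun i => l.step i⟩, ?_, hl⟩
  exact (l 0).2

lemma length_le_ringKrullDim {R : Type*} [CommRing R] (l : LTSeries (PrimeSpectrum R)) :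
    (l.length : WithBot ℕ∞) ≤ ringKrullDim R :=
  Order.le_krullDim_iff.2 ⟨l, rfl⟩

lemma ringKrullDim_mvPolynomial_fin (n : ℕ) :
    ringKrullDim (MvPolynomial (Fin n) ℂ) = n := by
  simp [MvPolynomial.ringKrullDim_of_isNoetherianRing, ringKrullDim_eq_zero_of_field]

/-- Krull dimensions of homogeneous coordinate rings are finite, so nothing is lost in the
truncation in the definition of `projDim`. -/
lemma ringKrullDim_homogeneousIdeal {N : ℕ} (V : Set (PN N)) :
    ringKrullDim (CoordRing N ⧸ homogeneousIdeal V) = ⊥ ∨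
      ∃ k : ℕ, ringKrullDim (CoordRing N ⧸ homogeneousIdeal V) = k := by
  have h : ringKrullDim (CoordRing N ⧸ homogeneousIdeal V) ≤ ((N + 1 : ℕ) : WithBot ℕ∞) := by
    rw [← ringKrullDim_mvPolynomial_fin]
    exact ringKrullDim_quotient_le _
  induction hd : ringKrullDim (CoordRing N ⧸ homogeneousIdeal V) using WithBot.recBotCoe with
  | bot => exact Or.inl rfl
  | coe d =>
    right
    rw [hd] at h
    have h' : d ≤ ((N + 1 : ℕ) : ℕ∞) := by exact_mod_cast h
    obtain ⟨k, rfl⟩ := ENat.ne_top_iff_exists.1 (ne_top_of_le_ne_top (ENat.natCast_ne_top _) h')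
    exact ⟨k, rfl⟩

lemma le_projDim {N m : ℕ} {V : Set (PN N)}
    (h : (m : WithBot ℕ∞) ≤ ringKrullDim (CoordRing N ⧸ homogeneousIdeal V)) :
    (m : ℤ) - 1 ≤ projDim V := by
  rw [projDim]
  rcases ringKrullDim_homogeneousIdeal V with hd | ⟨k, hd⟩
  · rw [hd] at h
    simp at h
  · rw [hd] at h ⊢
    have h' : m ≤ k := by exact_mod_cast h
    have : ((((k : ℕ) : WithBot ℕ∞).unbotD 0).toNat) = k := rfl
    rw [this]
    omega

lemma projDim_le {N m : ℕ} {V : Set (PN N)}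
    (h : ringKrullDim (CoordRing N ⧸ homogeneousIdeal V) ≤ m) :
    projDim V ≤ (m : ℤ) - 1 := by
  rw [projDim]
  rcases ringKrullDim_homogeneousIdeal V with hd | ⟨k, hd⟩
  · rw [hd]
    simp
    omega
  · rw [hd] at h ⊢
    have h' : k ≤ m := by exact_mod_cast h
    have : ((((k : ℕ) : WithBot ℕ∞).unbotD 0).toNat) = k := rfl
    rw [this]
    omega

lemma le_ringKrullDim_of_projDim_eq {N m : ℕ} {V : Set (PN N)} (hm : m ≠ 0)
    (h : projDim V = (m : ℤ) - 1) :
    (m : WithBot ℕ∞) ≤ ringKrullDim (CoordRing N ⧸ homogeneousIdeal V) := by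
  rw [projDim] at h
  rcases ringKrullDim_homogeneousIdeal V with hd | ⟨k, hd⟩
  · rw [hd] at h
    simp at h
    omega
  · rw [hd] at h ⊢
    have : ((((k : ℕ) : WithBot ℕ∞).unbotD 0).toNat) = k := rfl
    rw [this] at h
    have h' : m = k := by omega
    rw [h']

lemma neg_one_le_projDim {N : ℕ} (V : Set (PN N)) : -1 ≤ projDim V := by
  rw [projDim]; omega

lemma apply_eq_sum_mul_single {n d : ℕ} (l : (Fin n → ℂ) →ₗ[ℂ] (Fin d → ℂ)) (w : Fin n → ℂ)
    (i : Fin d) : l w i = ∑ k, w k * l (Pi.single k 1) i := by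
  rw [LinearMap.pi_apply_eq_sum_univ l w]
  simp only [Finset.sum_apply, Pi.smul_apply, smul_eq_mul]
  refine Finset.sum_congr rfl fun k _ => ?_
  have : (fun j => if k = j then (1 : ℂ) else 0) = Pi.single k 1 := by
    ext i
    simp [Pi.single_apply, eq_comm]
  rw [this]

/-- The coordinate ring of a linear subspace `W` is generated by `finrank W` elements. -/
lemma ringKrullDim_quotient_le_finrank {n : ℕ} (W : Submodule ℂ (Fin n → ℂ))
    (P : Ideal (MvPolynomial (Fin n) ℂ)) (hP : ∀ f, (∀ w ∈ W, eval w f = 0) → f ∈ P) :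
    ringKrullDim (MvPolynomial (Fin n) ℂ ⧸ P) ≤ Module.finrank ℂ W := by
  set d := Module.finrank ℂ W
  let b := Module.finBasis ℂ W
  obtain ⟨l, hl⟩ := LinearMap.exists_extend (b.equivFun : W →ₗ[ℂ] (Fin d → ℂ))
  let L : Fin d → MvPolynomial (Fin n) ℂ := fun j => ∑ k, C (l (Pi.single k 1) j) * X k
  have hL : ∀ j w, eval w (L j) = l w j := by
    intro j w
    rw [apply_eq_sum_mul_single]
    simp [L, mul_comm]
  let ψ : MvPolynomial (Fin d) ℂ →ₐ[ℂ] MvPolynomial (Fin n) ℂ ⧸ P :=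
    aeval fun j => Ideal.Quotient.mkₐ ℂ P (L j)
  rw [← ringKrullDim_mvPolynomial_fin d]
  apply ringKrullDim_le_of_surjective ψ.toRingHom
  have hr : ψ.range = ⊤ := by
    have h2 : (Ideal.Quotient.mkₐ ℂ P).range ≤ ψ.range := by
      rw [← Algebra.map_top, ← MvPolynomial.adjoin_range_X, AlgHom.map_adjoin,
        Algebra.adjoin_le_iff]
      rintro _ ⟨_, ⟨i, rfl⟩, rfl⟩
      -- on `W`, the coordinate `X i` is a linear combination of the forms `L j`
      refine ⟨∑ j, C ((b j : Fin n → ℂ) i) * X j, ?_⟩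
      have h3 : ∑ j, C ((b j : Fin n → ℂ) i) * L j - X i ∈ P := by
        refine hP _ fun w hw => ?_
        have h4 : ∀ j, l w j = b.repr ⟨w, hw⟩ j := fun j =>
          congrFun (congrArg (fun g => g ⟨w, hw⟩) hl) j
        have h5 : _ = w i := congrFun (congrArg (Subtype.val) (b.sum_repr ⟨w, hw⟩)) i
        simp only [map_sub, map_sum, map_mul, eval_C, eval_X, hL, h4]
        rw [Submodule.coe_sum, Finset.sum_apply] at h5
        rw [sub_eq_zero, ← h5]
        exact Finset.sum_congr rfl fun j _ => mul_comm _ _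
      have h4 := (Ideal.Quotient.eq (I := P)).2 h3
      change ψ _ = Ideal.Quotient.mk P (X i)
      rw [← h4]
      simp only [ψ, map_sum, map_mul, aeval_X]
      refine Finset.sum_congr rfl fun j _ => ?_
      rw [← algebraMap_eq, AlgHom.commutes]
      rfl
    rw [eq_top_iff]
    refine le_trans ?_ h2
    rw [(AlgHom.range_eq_top _).2 (Ideal.Quotient.mkₐ_surjective ℂ P)]
  exact (AlgHom.range_eq_top ψ).1 hr

/-! ### The singular locus contains a linear subspace of codimension two -/

/-- The polynomial `f (x + t z)` in `t`, for a polynomial `f` in `x`. -/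
noncomputable def shift {n : ℕ} (z : Fin n → ℂ) :
    MvPolynomial (Fin n) ℂ →ₐ[ℂ] Polynomial (MvPolynomial (Fin n) ℂ) :=
  aeval fun i => Polynomial.C (X i) + Polynomial.X * Polynomial.C (C (z i))

lemma eval_map_shift {n : ℕ} (z w : Fin n → ℂ) (t : ℂ) (f : MvPolynomial (Fin n) ℂ) :
    ((shift z f).map (eval w)).eval t = eval (w + t • z) f := by
  have : ((Polynomial.evalRingHom t).comp (Polynomial.mapRingHom (eval w))).comp
      (shift z : MvPolynomial (Fin n) ℂ →+* _) = eval (w + t • z) := by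
    apply MvPolynomial.ringHom_ext
    · intro c
      simp [shift, ← algebraMap_eq, Polynomial.algebraMap_apply]
    · intro i
      simp [shift]
      ring
  exact congrArg (fun φ : MvPolynomial (Fin n) ℂ →+* ℂ => φ f) this

/-- For a prime ideal `P`, the ideal of the points `w + t z` with `w ∈ V(P)`, that is, of the join
of `V(P)` with `z`. As the preimage of the prime ideal `P[t]`, it is prime. -/
noncomputable def joinIdeal {n : ℕ} (P : Ideal (MvPolynomial (Fin n) ℂ)) (z : Fin n → ℂ) :
    Ideal (MvPolynomial (Fin n) ℂ) :=
  (Ideal.map Polynomial.C P).comap (shift z)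

instance {n : ℕ} (P : Ideal (MvPolynomial (Fin n) ℂ)) [P.IsPrime] (z : Fin n → ℂ) :
    (joinIdeal P z).IsPrime :=
  inferInstanceAs ((Ideal.map Polynomial.C P).comap (shift z)).IsPrime

lemma mem_iff_of_isPrime {n : ℕ} {P : Ideal (MvPolynomial (Fin n) ℂ)} [P.IsPrime]
    {f : MvPolynomial (Fin n) ℂ} : f ∈ P ↔ ∀ w ∈ zeroLocus ℂ P, eval w f = 0 := by
  conv_lhs => rw [← MvPolynomial.IsPrime.vanishingIdeal_zeroLocus (K := ℂ) P]
  rfl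

lemma mem_joinIdeal {n : ℕ} {P : Ideal (MvPolynomial (Fin n) ℂ)} [P.IsPrime] {z : Fin n → ℂ}
    {f : MvPolynomial (Fin n) ℂ} :
    f ∈ joinIdeal P z ↔ ∀ w ∈ zeroLocus ℂ P, ∀ t : ℂ, eval (w + t • z) f = 0 := by
  rw [joinIdeal, Ideal.mem_comap, Ideal.mem_map_C_iff]
  simp only [mem_iff_of_isPrime (P := P), ← eval_map_shift]
  constructor
  · intro h w hw t
    have : (shift z f).map (eval w) = 0 := by
      ext k
      simpa using h k w hw
    rw [this, Polynomial.eval_zero]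
  · intro h k w hw
    have : (shift z f).map (eval w) = 0 := Polynomial.funext fun t => by
      simpa using h w hw t
    have h2 := congrArg (fun p => Polynomial.coeff p k) this
    simpa using h2

/-- A component of codimension two of the singular locus of a cubic hypersurface which is not a
cone is stable under joins with its points. The join of `V(P)` with one of its points `z` lies in
the hypersurface, as a line through two singular points of a cubic does. If the join were larger
than `V(P)`, it would be the whole hypersurface, by dimension, and the hypersurface would be a cone
with vertex `z`. -/
lemma joinIdeal_eq {N : ℕ} {F : CoordRing N} (hF : F.IsHomogeneous 3) (hirr : Irreducible F)
    (hcone : ¬ IsCone (zeroSet F)) {T} (hT : IsPolarForm F T) {P : Ideal (CoordRing N)}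
    [P.IsPrime] (hP : ∀ w ∈ zeroLocus ℂ P, T w w = 0)
    (hht : ∀ Q₀ Q₁ Q₂ : Ideal (CoordRing N), Q₀.IsPrime → Q₁.IsPrime → Q₂.IsPrime →
      Q₀ < Q₁ → Q₁ < Q₂ → ¬ Q₂ < P)
    {z : Fin (N + 1) → ℂ} (hz : z ∈ zeroLocus ℂ P) : joinIdeal P z = P := by
  by_contra hne
  have hz0 : z ≠ 0 := by
    rintro rfl
    apply hne
    ext f
    rw [mem_joinIdeal, mem_iff_of_isPrime (P := P)]
    simp
  have hle : joinIdeal P z ≤ P := by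
    intro f hf
    rw [mem_iff_of_isPrime]
    intro w hw
    simpa using mem_joinIdeal.1 hf w hw 0
  have hTz : ∀ x, T z z x = 0 := fun x => by rw [hP z hz]; rfl
  have hTz₂ : ∀ x, T z x z = 0 := fun x => by rw [hT.swap₂₃, hTz]
  have hTz₃ : ∀ x, T x z z = 0 := fun x => by rw [hT.swap₁₂, hTz₂]
  have hFJ : F ∈ joinIdeal P z := by
    rw [mem_joinIdeal]
    intro w hw t
    have h1 : ∀ x, T w w x = 0 := fun x => by rw [hP w hw]; rfl
    have h2 : ∀ x, T w x w = 0 := fun x => by rw [hT.swap₂₃, h1]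
    have h3 : ∀ x, T x w w = 0 := fun x => by rw [hT.swap₁₂, h2]
    rw [hT.eval_eq]
    simp [h1, h2, h3, hTz, hTz₂, hTz₃]
  have hFp : (Ideal.span {F}).IsPrime :=
    (Ideal.span_singleton_prime hirr.ne_zero).2 hirr.prime
  have hJ : joinIdeal P z = Ideal.span {F} := by
    by_contra hJ
    refine hht ⊥ (Ideal.span {F}) (joinIdeal P z) Ideal.isPrime_bot hFp inferInstance ?_ ?_
      (lt_of_le_of_ne hle hne)
    · rw [bot_lt_iff_ne_bot, Ne, Ideal.span_singleton_eq_bot]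
      exact hirr.ne_zero
    · refine lt_of_le_of_ne ?_ (Ne.symm hJ)
      rwa [Ideal.span_singleton_le_iff_mem]
  -- the derivative of `F` in the direction `z`
  set D : CoordRing N := ∑ i, pderiv i F * C (z i) with hD
  have hDe : ∀ v, eval v D = 3 * T v v z := by
    intro v
    rw [← hT.sum_pderiv]
    simp [hD]
  have hDJ : D ∈ joinIdeal P z := by
    rw [mem_joinIdeal]
    intro w hw t
    have h1 : ∀ x, T w w x = 0 := fun x => by rw [hP w hw]; rfl
    rw [hDe]
    simp [h1, hTz, hTz₂, hTz₃]
  rw [hJ, Ideal.mem_span_singleton] at hDJ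
  have hD0 : D = 0 := by
    by_contra hD0
    obtain ⟨q, hq⟩ := hDJ
    have hq0 : q ≠ 0 := by rintro rfl; exact hD0 (by rw [hq, mul_zero])
    have h1 := totalDegree_mul_of_isDomain hirr.ne_zero hq0
    have h2 : D.totalDegree ≤ 2 := by
      rw [hD]
      refine totalDegree_finsetSum_le fun i _ => ?_
      refine (totalDegree_mul _ _).trans ?_
      rw [totalDegree_C, add_zero]
      exact (hF.pderiv (i := i)).totalDegree_le
    rw [← hq, hF.totalDegree hirr.ne_zero] at h1
    omega
  have hvv : ∀ v, T v v z = 0 := fun v => by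
    have := hDe v
    rw [hD0] at this
    simpa using this.symm
  apply hcone
  refine hT.isCone hF hz0 (LinearMap.ext fun x => LinearMap.ext fun y => ?_)
  have h1 := hvv (x + y)
  simp only [map_add, LinearMap.add_apply, hvv, zero_add, add_zero, hT.swap₁₂ y x] at h1
  rw [hT.swap₁₂, hT.swap₂₃]
  simp only [LinearMap.zero_apply]
  linear_combination h1 / 2

lemma exists_submodule_le_finrank_eq {V : Type*} [AddCommGroup V] [Module ℂ V]
    [FiniteDimensional ℂ V] (W : Submodule ℂ V) {m : ℕ} (h : m ≤ Module.finrank ℂ W) :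
    ∃ W' ≤ W, Module.finrank ℂ W' = m := by
  let b := Module.finBasis ℂ W
  have hli : LinearIndependent ℂ fun i : Fin m => ((b (Fin.castLE h i) : W) : V) :=
    (b.linearIndependent.map' W.subtype (by simp)).comp _ (Fin.castLE_injective h)
  refine ⟨Submodule.span ℂ (Set.range fun i : Fin m => ((b (Fin.castLE h i) : W) : V)), ?_, ?_⟩
  · rw [Submodule.span_le]
    rintro _ ⟨i, rfl⟩
    exact (b _).2
  · rw [finrank_span_eq_card hli, Fintype.card_fin]

/-- The prime `P` at the bottom of a chain of length `N - 1` above the ideal of the singular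
locus has height at most two, so `joinIdeal_eq` applies to it. -/
theorem exists_linear_singular_subspace {N : ℕ} {F : CoordRing N} (hF : F.IsHomogeneous 3)
    (hirr : Irreducible F) (hcone : ¬ IsCone (zeroSet F)) {T} (hT : IsPolarForm F T)
    (hsing : projDim (singularLocus F) = (N : ℤ) - 2) :
    ∃ W : Submodule ℂ (Fin (N + 1) → ℂ),
      Module.finrank ℂ W + 1 = N ∧ ∀ w ∈ W, T w w = 0 := by
  have hN : 1 ≤ N := by
    have := neg_one_le_projDim (singularLocus F)
    omega
  obtain ⟨m, rfl⟩ : ∃ m, N = m + 1 := ⟨N - 1, by omega⟩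
  rcases Nat.eq_zero_or_pos m with rfl | hm
  · -- for `N = 1` the singular locus is empty, and `W = 0`
    exact ⟨⊥, by simp, by simp⟩
  have hdim := le_ringKrullDim_of_projDim_eq (V := singularLocus F) (m := m) hm.ne'
    (by rw [hsing]; push_cast; ring)
  obtain ⟨l, hl, hlen⟩ := exists_ltSeries_of_le_ringKrullDim_quotient hdim
  set P := l.head.asIdeal with hPdef
  have hPdim : (m : WithBot ℕ∞) ≤ ringKrullDim (CoordRing (m + 1) ⧸ P) := by
    have := length_le_ringKrullDim_quotient (I := P) l le_rfl
    rwa [hlen] at this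
  have hht : ∀ Q₀ Q₁ Q₂ : Ideal (CoordRing (m + 1)), Q₀.IsPrime → Q₁.IsPrime → Q₂.IsPrime →
      Q₀ < Q₁ → Q₁ < Q₂ → ¬ Q₂ < P := by
    intro Q₀ Q₁ Q₂ h₀ h₁ h₂ h01 h12 h2
    let l₂ := RelSeries.cons l ⟨Q₂, h₂⟩ h2
    let l₁ := RelSeries.cons l₂ ⟨Q₁, h₁⟩ (by rw [RelSeries.head_cons]; exact h12)
    let l₀ := RelSeries.cons l₁ ⟨Q₀, h₀⟩ (by rw [RelSeries.head_cons]; exact h01)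
    have h3 : l₀.length = m + 3 := by simp [l₀, l₁, l₂, hlen]
    have h4 := length_le_ringKrullDim l₀
    rw [ringKrullDim_mvPolynomial_fin, h3] at h4
    have h5 : m + 3 ≤ m + 1 + 1 := by exact_mod_cast h4
    omega
  have hsg : ∀ w ∈ zeroLocus ℂ P, T w w = 0 := by
    intro w hw
    rw [← hT.grad_eq_zero_iff]
    ext i
    have : pderiv i F ∈ homogeneousIdeal (singularLocus F) := by
      rintro v ⟨hv, hmem⟩
      rw [hT.mk_mem_singularLocus hF, ← hT.grad_eq_zero_iff] at hmem
      simpa [grad] using congrFun hmem i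
    simpa [grad] using hw _ (hl this)
  have hadd : ∀ w ∈ zeroLocus ℂ P, ∀ z ∈ zeroLocus ℂ P, ∀ t : ℂ, w + t • z ∈ zeroLocus ℂ P := by
    intro w hw z hz t f hf
    rw [← joinIdeal_eq hF hirr hcone hT hsg hht hz] at hf
    simpa using mem_joinIdeal.1 hf w hw t
  obtain ⟨z₀, hz₀⟩ : (zeroLocus ℂ P).Nonempty := by
    rw [Set.nonempty_iff_ne_empty]
    intro he
    have := MvPolynomial.IsPrime.vanishingIdeal_zeroLocus (K := ℂ) P
    rw [he, vanishingIdeal_empty] at this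
    exact l.head.2.ne_top this.symm
  -- closure under `w + t z` for two points of `V(P)` makes `V(P)` a linear subspace
  let W : Submodule ℂ (Fin (m + 1 + 1) → ℂ) :=
    { carrier := zeroLocus ℂ P
      zero_mem' := by simpa using hadd z₀ hz₀ z₀ hz₀ (-1)
      add_mem' := fun {a b} ha hb => by simpa using hadd a ha b hb 1
      smul_mem' := fun c x hx => by
        have := hadd x hx x hx (c - 1)
        rwa [sub_smul, one_smul, add_sub_cancel] at this }
  have hW : m ≤ Module.finrank ℂ W := by
    have := hPdim.trans (ringKrullDim_quotient_le_finrank W P fun f hf => mem_iff_of_isPrime.2 hf)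
    exact_mod_cast this
  obtain ⟨W', hW', hfin⟩ := exists_submodule_le_finrank_eq W hW
  exact ⟨W', by rw [hfin], fun w hw => hsg w (hW' hw)⟩

/-! ### Linear changes of coordinates -/

/-- Substitution of the linear map `l` into polynomials. -/
noncomputable def linSubst {n : ℕ} (l : (Fin n → ℂ) →ₗ[ℂ] (Fin n → ℂ)) :
    MvPolynomial (Fin n) ℂ →ₐ[ℂ] MvPolynomial (Fin n) ℂ :=
  aeval fun i => ∑ k, C (l (Pi.single k 1) i) * X k

lemma eval_linSubst {n : ℕ} (l : (Fin n → ℂ) →ₗ[ℂ] (Fin n → ℂ)) (x : Fin n → ℂ)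
    (f : MvPolynomial (Fin n) ℂ) : eval x (linSubst l f) = eval (l x) f := by
  have : (aeval x : _ →ₐ[ℂ] ℂ).comp (linSubst l) = aeval (l x) := by
    apply MvPolynomial.algHom_ext
    intro i
    simp [linSubst, apply_eq_sum_mul_single l x, mul_comm]
  exact congrArg (fun φ : _ →ₐ[ℂ] ℂ => φ f) this

/-- The automorphism of the polynomial ring given by an invertible linear substitution. -/
noncomputable def linSubstEquiv {n : ℕ} (e : (Fin n → ℂ) ≃ₗ[ℂ] (Fin n → ℂ)) :
    MvPolynomial (Fin n) ℂ ≃ₐ[ℂ] MvPolynomial (Fin n) ℂ :=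
  AlgEquiv.ofAlgHom (linSubst e.toLinearMap) (linSubst e.symm.toLinearMap)
    (AlgHom.ext fun f => MvPolynomial.funext fun x => by simp [eval_linSubst])
    (AlgHom.ext fun f => MvPolynomial.funext fun x => by simp [eval_linSubst])

lemma eval_linSubstEquiv {n : ℕ} (e : (Fin n → ℂ) ≃ₗ[ℂ] (Fin n → ℂ)) (x : Fin n → ℂ)
    (f : MvPolynomial (Fin n) ℂ) : eval x (linSubstEquiv e f) = eval (e x) f :=
  eval_linSubst _ _ _

section CoordinateChange

variable {N : ℕ} {F G : CoordRing N} {e : (Fin (N + 1) → ℂ) ≃ₗ[ℂ] (Fin (N + 1) → ℂ)}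

lemma eq_linSubstEquiv (h : ∀ x, eval x G = eval (e x) F) : G = linSubstEquiv e F :=
  MvPolynomial.funext fun x => by rw [h, eval_linSubstEquiv]

lemma irreducible_of_eval_eq (h : ∀ x, eval x G = eval (e x) F) (hF : Irreducible F) :
    Irreducible G := by
  rw [eq_linSubstEquiv h]
  exact (MulEquiv.irreducible_iff (linSubstEquiv e)).2 hF

lemma isHomogeneous_of_eval_eq {n : ℕ} (h : ∀ x, eval x G = eval (e x) F)
    (hF : F.IsHomogeneous n) : G.IsHomogeneous n := by
  have : G = linSubst e.toLinearMap F := eq_linSubstEquiv h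
  rw [this, linSubst, ← one_mul n]
  refine hF.aeval _ fun i => IsHomogeneous.sum _ _ _ fun k _ => ?_
  simpa using (isHomogeneous_C (Fin (N + 1)) _).mul (isHomogeneous_X ℂ k)

lemma IsPolarForm.comp {T} (hT : IsPolarForm F T) {S} (hS : IsPolarForm G S)
    (h : ∀ x, eval x G = eval (e x) F) (v w : Fin (N + 1) → ℂ) :
    S v v w = T (e v) (e v) (e w) := by
  have key : ∀ x, S x x x = T (e x) (e x) (e x) := fun x => by
    rw [← hS.eval_eq, h, hT.eval_eq]
  have h1 := key (v + w)
  have h2 := key (v - w)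
  have h3 := key w
  simp only [map_add, map_sub, LinearMap.add_apply, LinearMap.sub_apply] at h1 h2
  rw [hS.swap₂₃ v w v, hS.swap₁₂ w v v, hS.swap₂₃ v w v, hS.swap₂₃ w v w,
    hS.swap₁₂ w w v, hT.swap₂₃ (e v) (e w) (e v), hT.swap₁₂ (e w) (e v) (e v),
    hT.swap₂₃ (e v) (e w) (e v)] at h1 h2
  linear_combination (h1 - h2) / 6 - h3 / 3

/-- The transpose of a linear map, acting on coefficients of linear forms. -/
noncomputable def transposeMap (l : (Fin (N + 1) → ℂ) →ₗ[ℂ] (Fin (N + 1) → ℂ)) :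
    (Fin (N + 1) → ℂ) →ₗ[ℂ] (Fin (N + 1) → ℂ) :=
  LinearMap.pi fun k => ∑ i, (l (Pi.single k 1) i) • LinearMap.proj i

lemma sum_transposeMap (l : (Fin (N + 1) → ℂ) →ₗ[ℂ] (Fin (N + 1) → ℂ))
    (h w : Fin (N + 1) → ℂ) : ∑ k, transposeMap l h k * w k = ∑ i, h i * l w i := by
  simp only [transposeMap, LinearMap.pi_apply, LinearMap.sum_apply, LinearMap.smul_apply,
    LinearMap.proj_apply, smul_eq_mul, apply_eq_sum_mul_single l w, Finset.sum_mul, Finset.mul_sum]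
  rw [Finset.sum_comm]
  exact Finset.sum_congr rfl fun i _ => Finset.sum_congr rfl fun k _ => by ring

/-- The dual of a coordinate change, acting on coefficients of linear forms. -/
noncomputable def dualCoord (e : (Fin (N + 1) → ℂ) ≃ₗ[ℂ] (Fin (N + 1) → ℂ)) :
    (Fin (N + 1) → ℂ) ≃ₗ[ℂ] (Fin (N + 1) → ℂ) :=
  LinearEquiv.ofInjectiveEndo (transposeMap e.toLinearMap) (by
    rw [← LinearMap.ker_eq_bot, LinearMap.ker_eq_bot']
    intro h hh
    ext i
    have := sum_transposeMap e.toLinearMap h (e.symm (Pi.single i 1))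
    simpa [hh, Pi.single_apply] using this.symm)

lemma sum_dualCoord (h w : Fin (N + 1) → ℂ) :
    ∑ k, dualCoord e h k * w k = ∑ i, h i * e w i :=
  sum_transposeMap e.toLinearMap h w

lemma grad_of_eval_eq (hF : F.IsHomogeneous 3) (h : ∀ x, eval x G = eval (e x) F)
    (x : Fin (N + 1) → ℂ) : grad G x = dualCoord e (grad F (e x)) := by
  obtain ⟨T, hT⟩ := exists_isPolarForm hF
  obtain ⟨S, hS⟩ := exists_isPolarForm (isHomogeneous_of_eval_eq h hF)
  ext i
  have h1 := hS.sum_pderiv x (Pi.single i 1)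
  have h2 := hT.sum_pderiv (e x) (e (Pi.single i 1))
  rw [← hT.comp hS h] at h2
  have h3 := sum_dualCoord (e := e) (grad F (e x)) (Pi.single i 1)
  rw [← h1] at h2
  change ∑ i, grad F (e x) i * _ = ∑ i, grad G x i * _ at h2
  rw [← h3] at h2
  simpa [Pi.single_apply] using h2.symm

lemma ringKrullDim_dualVariety_of_eval_eq (hF : F.IsHomogeneous 3)
    (h : ∀ x, eval x G = eval (e x) F) :
    ringKrullDim (CoordRing N ⧸ homogeneousIdeal (dualVariety G)) =
      ringKrullDim (CoordRing N ⧸ homogeneousIdeal (dualVariety F)) := by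
  have hG := isHomogeneous_of_eval_eq h hF
  refine ringKrullDim_eq_of_ringEquiv
    (Ideal.quotientEquiv _ _ (linSubstEquiv (dualCoord e)).toRingEquiv ?_)
  ext g
  obtain ⟨f, rfl⟩ := (linSubstEquiv (dualCoord e)).surjective g
  have h1 : (linSubstEquiv (dualCoord e)) f ∈ Ideal.map
      ((linSubstEquiv (dualCoord e)).toRingEquiv : CoordRing N →+* CoordRing N)
      (homogeneousIdeal (dualVariety G)) ↔ f ∈ homogeneousIdeal (dualVariety G) := by
    refine (Ideal.mem_map_iff_of_surjective _
      (linSubstEquiv (dualCoord e)).toRingEquiv.surjective).trans ⟨?_, fun hf => ⟨f, hf, rfl⟩⟩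
    rintro ⟨x, hx, hxf⟩
    rwa [← (linSubstEquiv (dualCoord e)).injective hxf]
  rw [h1, mem_homogeneousIdeal_dualVariety hF, mem_homogeneousIdeal_dualVariety hG]
  simp only [grad_of_eval_eq hF h, h, eval_linSubstEquiv, ne_eq, LinearEquiv.map_eq_zero_iff]
  exact (e.surjective.forall (p := fun v => eval v F = 0 → ¬grad F v = 0 →
    eval (dualCoord e (grad F v)) f = 0))

lemma dualDefect_of_eval_eq (hF : F.IsHomogeneous 3) (h : ∀ x, eval x G = eval (e x) F) :
    dualDefect G = dualDefect F := by
  rw [dualDefect, dualDefect, projDim, projDim, ringKrullDim_dualVariety_of_eval_eq hF h]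

lemma projEquivalent_of_eval_eq {n : ℕ} (hF : F.IsHomogeneous n)
    (h : ∀ x, eval x G = eval (e x) F) : ProjEquivalent (zeroSet F) (zeroSet G) := by
  have hG := isHomogeneous_of_eval_eq h hF
  refine ⟨e.symm, Set.ext fun q => ⟨?_, fun hq => ?_⟩⟩
  · rintro ⟨p, hp, rfl⟩
    induction p using Projectivization.ind with
    | h v hv =>
      rw [mk_mem_zeroSet hF] at hp
      rw [Projectivization.map_mk, mk_mem_zeroSet hG, h]
      simpa using hp
  · induction q using Projectivization.ind with
    | h v hv =>
      rw [mk_mem_zeroSet hG, h] at hq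
      have hev : e v ≠ 0 := by simpa using hv
      refine ⟨Projectivization.mk ℂ (e v) hev, (mk_mem_zeroSet hF hev).2 hq, ?_⟩
      rw [Projectivization.map_mk]
      congr 1
      simp

end CoordinateChange

/-! ### Bounds for the dimension of a dual variety -/

/-- Specialisation increases the kernel of a parametrisation, and a strict increase raises the
dimension bound by one. -/
lemma succ_le_ringKrullDim_quotient_ker {R A B : Type*} [CommRing R] [CommRing A] [IsDomain A]
    [CommRing B] (φ : R →+* A) (σ : A →+* B) (f : R) (h₁ : φ f ≠ 0)
    (h₂ : σ (φ f) = 0) {n : ℕ}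
    (h : (n : WithBot ℕ∞) ≤ ringKrullDim (R ⧸ RingHom.ker (σ.comp φ))) :
    ((n + 1 : ℕ) : WithBot ℕ∞) ≤ ringKrullDim (R ⧸ RingHom.ker φ) := by
  obtain ⟨l, hl, hn⟩ := exists_ltSeries_of_le_ringKrullDim_quotient h
  have hle : RingHom.ker φ ≤ RingHom.ker (σ.comp φ) := fun x hx => by
    rw [RingHom.mem_ker] at hx ⊢
    simp [hx]
  have hlt : (⟨RingHom.ker φ, RingHom.ker_isPrime φ⟩ : PrimeSpectrum R) < l.head := by
    refine lt_of_le_of_ne (hle.trans hl) fun heq => h₁ ?_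
    have : f ∈ l.head.asIdeal := hl (by rw [RingHom.mem_ker]; exact h₂)
    rw [← heq] at this
    exact this
  have := length_le_ringKrullDim_quotient (I := RingHom.ker φ) (RelSeries.cons l _ hlt)
    (by rw [RelSeries.head_cons])
  rwa [RelSeries.cons_length, hn] at this

lemma zero_le_ringKrullDim_quotient_ker {R A : Type*} [CommRing R] [CommRing A] [Nontrivial A]
    (φ : R →+* A) : ((0 : ℕ) : WithBot ℕ∞) ≤ ringKrullDim (R ⧸ RingHom.ker φ) := by
  have : Nontrivial (R ⧸ RingHom.ker φ) :=
    Ideal.Quotient.nontrivial_iff.2 (RingHom.ker_ne_top φ)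
  exact_mod_cast ringKrullDim_nonneg_of_nontrivial

lemma ringKrullDim_quotient_anti {R : Type*} [CommRing R] {I J : Ideal R} (h : I ≤ J) :
    ringKrullDim (R ⧸ J) ≤ ringKrullDim (R ⧸ I) :=
  ringKrullDim_le_of_surjective (Ideal.Quotient.factor h) (Ideal.Quotient.factor_surjective h)

/-- A polynomial parametrisation `p` of points of the hypersurface, generically smooth, gives a
parametrisation of a subvariety of the dual variety by the gradients. -/
lemma homogeneousIdeal_dualVariety_le_ker {N d : ℕ} {F : CoordRing N} (hF : F.IsHomogeneous 3)
    (p y : Fin (N + 1) → MvPolynomial (Fin d) ℂ)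
    (hp : ∀ t : Fin d → ℂ, eval (fun i => eval t (p i)) F = 0)
    (hy : ∀ (t : Fin d → ℂ) (i), grad F (fun i => eval t (p i)) i = eval t (y i))
    {k : Fin (N + 1)} (hk : y k ≠ 0) :
    homogeneousIdeal (dualVariety F) ≤
      RingHom.ker (aeval y : CoordRing N →ₐ[ℂ] MvPolynomial (Fin d) ℂ).toRingHom := by
  intro g hg
  rw [mem_homogeneousIdeal_dualVariety hF] at hg
  rw [RingHom.mem_ker]
  have h : aeval y g * y k = 0 := by
    apply MvPolynomial.funext
    intro t
    have h1 : eval t (aeval y g) = eval (fun i => eval t (y i)) g := by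
      have : (aeval t : _ →ₐ[ℂ] ℂ).comp (aeval y) = aeval (fun i => eval t (y i)) := by
        apply MvPolynomial.algHom_ext
        intro i
        simp [aeval_eq_eval]
      exact congrArg (fun φ : _ →ₐ[ℂ] ℂ => φ g) this
    have h2 : grad F (fun i => eval t (p i)) = fun i => eval t (y i) := funext (hy t)
    rw [map_mul, map_zero, h1, ← h2]
    by_cases h0 : grad F (fun i => eval t (p i)) = 0
    · have := congrFun h0 k
      rw [hy] at this
      rw [this]
      simp
    · rw [hg _ (hp t) h0, zero_mul]
  exact (mul_eq_zero.1 h).resolve_right hk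

lemma ne_zero_of_eval {n : ℕ} {f : MvPolynomial (Fin n) ℂ} (t : Fin n → ℂ) (h : eval t f ≠ 0) :
    f ≠ 0 := by
  rintro rfl
  simp at h

lemma dualDefect_nonpos {N : ℕ} {F : CoordRing N}
    (h : (N : WithBot ℕ∞) ≤ ringKrullDim (CoordRing N ⧸ homogeneousIdeal (dualVariety F))) :
    dualDefect F ≤ 0 := by
  have := le_projDim h
  rw [dualDefect]
  omega

/-! ### Cubics singular along a linear space, in coordinates -/

/-- The plane cubics with a cusp, for `k ≠ 0`. -/
noncomputable def cuspCubic (k : ℂ) : CoordRing 2 := C k * X 0 ^ 3 + X 1 ^ 2 * X 2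

/-- The plane cubics with a node, for `α` and `β` nonzero. -/
noncomputable def nodeCubic (α β : ℂ) : CoordRing 2 :=
  C α * X 0 ^ 3 + C β * X 1 ^ 3 + X 0 * X 1 * X 2

/-- The ruled cubic surface with two pinch points. -/
noncomputable def whitneyCubic : CoordRing 3 := X 0 ^ 2 * X 2 + X 1 ^ 2 * X 3

/-- Cayley's ruled cubic surfaces, for `k ≠ 0`: their two line directrices coincide. -/
noncomputable def cayleyCubic (k : ℂ) : CoordRing 3 :=
  C k * X 0 ^ 3 + X 0 * X 1 * X 2 + X 1 ^ 2 * X 3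

lemma isHomogeneous_cuspCubic (k : ℂ) : (cuspCubic k).IsHomogeneous 3 :=
  IsHomogeneous.add (by simpa using (isHomogeneous_C _ k).mul (isHomogeneous_X_pow 0 3))
    (((isHomogeneous_X_pow 1 2)).mul (isHomogeneous_X ℂ 2))

lemma isHomogeneous_nodeCubic (α β : ℂ) : (nodeCubic α β).IsHomogeneous 3 :=
  IsHomogeneous.add (IsHomogeneous.add
    (by simpa using (isHomogeneous_C _ α).mul (isHomogeneous_X_pow 0 3))
    (by simpa using (isHomogeneous_C _ β).mul (isHomogeneous_X_pow 1 3)))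
    (((isHomogeneous_X ℂ 0).mul (isHomogeneous_X ℂ 1)).mul (isHomogeneous_X ℂ 2))

lemma isHomogeneous_whitneyCubic : whitneyCubic.IsHomogeneous 3 :=
  IsHomogeneous.add ((isHomogeneous_X_pow 0 2).mul (isHomogeneous_X ℂ 2))
    ((isHomogeneous_X_pow 1 2).mul (isHomogeneous_X ℂ 3))

lemma isHomogeneous_cayleyCubic (k : ℂ) : (cayleyCubic k).IsHomogeneous 3 :=
  IsHomogeneous.add (IsHomogeneous.add
    (by simpa using (isHomogeneous_C _ k).mul (isHomogeneous_X_pow 0 3))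
    (((isHomogeneous_X ℂ 0).mul (isHomogeneous_X ℂ 1)).mul (isHomogeneous_X ℂ 2)))
    ((isHomogeneous_X_pow 1 2).mul (isHomogeneous_X ℂ 3))

lemma isHomogeneous_perazzoCubic : perazzoCubic.IsHomogeneous 3 :=
  IsHomogeneous.add (IsHomogeneous.add
    (((isHomogeneous_X ℂ 0).mul (isHomogeneous_X ℂ 1)).mul (isHomogeneous_X ℂ 2))
    ((isHomogeneous_X_pow 0 2).mul (isHomogeneous_X ℂ 4)))
    ((isHomogeneous_X_pow 1 2).mul (isHomogeneous_X ℂ 3))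

lemma grad_cuspCubic (k : ℂ) (x : Fin 3 → ℂ) :
    grad (cuspCubic k) x = ![3 * k * x 0 ^ 2, 2 * x 1 * x 2, x 1 ^ 2] := by
  ext i
  fin_cases i <;> simp [grad, cuspCubic, pderiv_X] <;> ring

lemma grad_nodeCubic (α β : ℂ) (x : Fin 3 → ℂ) :
    grad (nodeCubic α β) x =
      ![3 * α * x 0 ^ 2 + x 1 * x 2, 3 * β * x 1 ^ 2 + x 0 * x 2, x 0 * x 1] := by
  ext i
  fin_cases i <;> simp [grad, nodeCubic, pderiv_X] <;> ring

lemma grad_whitneyCubic (x : Fin 4 → ℂ) :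
    grad whitneyCubic x = ![2 * x 0 * x 2, 2 * x 1 * x 3, x 0 ^ 2, x 1 ^ 2] := by
  ext i
  fin_cases i <;> simp [grad, whitneyCubic, pderiv_X] <;> ring

lemma grad_cayleyCubic (k : ℂ) (x : Fin 4 → ℂ) :
    grad (cayleyCubic k) x =
      ![3 * k * x 0 ^ 2 + x 1 * x 2, x 0 * x 2 + 2 * x 1 * x 3, x 0 * x 1, x 1 ^ 2] := by
  ext i
  fin_cases i <;> simp [grad, cayleyCubic, pderiv_X] <;> ring

lemma grad_perazzoCubic (x : Fin 5 → ℂ) :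
    grad perazzoCubic x =
      ![x 1 * x 2 + 2 * x 0 * x 4, x 0 * x 2 + 2 * x 1 * x 3, x 0 * x 1, x 1 ^ 2, x 0 ^ 2] := by
  ext i
  fin_cases i <;> simp [grad, perazzoCubic, pderiv_X] <;> ring

lemma dualDefect_cuspCubic_nonpos {k : ℂ} (hk : k ≠ 0) : dualDefect (cuspCubic k) ≤ 0 := by
  apply dualDefect_nonpos
  -- parametrisation by `(x₀, x₁, x₂) = (ab, a, -k a b³)`
  let y : Fin 3 → MvPolynomial (Fin 2) ℂ :=
    ![C (3 * k) * X 0 ^ 2 * X 1 ^ 2, C (-2 * k) * X 0 ^ 2 * X 1 ^ 3, X 0 ^ 2]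
  refine le_trans ?_ (ringKrullDim_quotient_anti (homogeneousIdeal_dualVariety_le_ker
    (isHomogeneous_cuspCubic k) ![X 0 * X 1, X 0, C (-k) * X 0 * X 1 ^ 3] y ?_ ?_ (k := 2) ?_))
  · refine succ_le_ringKrullDim_quotient_ker _
      (aeval ![X 0, 0] : MvPolynomial (Fin 2) ℂ →ₐ[ℂ] MvPolynomial (Fin 2) ℂ).toRingHom (X 0)
      ?_ ?_ (n := 1) ?_
    · apply ne_zero_of_eval 1
      simp [y, hk]
    · simp [y]
    refine succ_le_ringKrullDim_quotient_ker _
      (aeval ![0, 0] : MvPolynomial (Fin 2) ℂ →ₐ[ℂ] MvPolynomial (Fin 2) ℂ).toRingHom (X 2)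
      ?_ ?_ (n := 0) (zero_le_ringKrullDim_quotient_ker _)
    · apply ne_zero_of_eval 1
      simp [y]
    · simp [y]
  · intro t
    simp [cuspCubic]
    ring
  · intro t i
    rw [grad_cuspCubic]
    fin_cases i <;> simp [y] <;> ring
  · apply ne_zero_of_eval 1
    simp [y]

lemma dualDefect_nodeCubic_nonpos {α : ℂ} (hα : α ≠ 0) (β : ℂ) :
    dualDefect (nodeCubic α β) ≤ 0 := by
  apply dualDefect_nonpos
  -- parametrisation by `(x₀, x₁, x₂) = (c s², c s, -c (α s³ + β))`
  let y : Fin 3 → MvPolynomial (Fin 2) ℂ :=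
    ![X 0 ^ 2 * (C (2 * α) * X 1 ^ 4 - C β * X 1), X 0 ^ 2 * (C (2 * β) * X 1 ^ 2 - C α * X 1 ^ 5),
      X 0 ^ 2 * X 1 ^ 3]
  refine le_trans ?_ (ringKrullDim_quotient_anti (homogeneousIdeal_dualVariety_le_ker
    (isHomogeneous_nodeCubic α β) ![X 0 * X 1 ^ 2, X 0 * X 1, -X 0 * (C α * X 1 ^ 3 + C β)]
    y ?_ ?_ (k := 2) ?_))
  · -- at `s = 1` the parametrisation degenerates to a single point of the dual curve
    refine succ_le_ringKrullDim_quotient_ker _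
      (aeval ![X 0, 1] : MvPolynomial (Fin 2) ℂ →ₐ[ℂ] MvPolynomial (Fin 2) ℂ).toRingHom
      (X 0 - C (2 * α - β) * X 2) ?_ ?_ (n := 1) ?_
    · apply ne_zero_of_eval ![1, -1]
      simp only [y, AlgHom.toRingHom_eq_coe, RingHom.coe_coe, map_sub, map_mul, aeval_X,
        algHom_C, algebraMap_eq, Matrix.cons_val, map_pow, eval_X, eval_C]
      intro h
      exact hα (by linear_combination h / 4)
    · simp [y]
      ring
    refine succ_le_ringKrullDim_quotient_ker _
      (aeval ![0, 0] : MvPolynomial (Fin 2) ℂ →ₐ[ℂ] MvPolynomial (Fin 2) ℂ).toRingHom (X 2)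
      ?_ ?_ (n := 0) (zero_le_ringKrullDim_quotient_ker _)
    · apply ne_zero_of_eval 1
      simp [y]
    · simp [y]
  · intro t
    simp [nodeCubic]
    ring
  · intro t i
    rw [grad_nodeCubic]
    fin_cases i <;> simp [y] <;> ring
  · apply ne_zero_of_eval 1
    simp [y]

lemma dualDefect_whitneyCubic_nonpos : dualDefect whitneyCubic ≤ 0 := by
  apply dualDefect_nonpos
  -- parametrisation by `(x₀, x₁, x₂, x₃) = (a, b, -b² s, a² s)`
  let y : Fin 4 → MvPolynomial (Fin 3) ℂ :=
    ![-2 * X 0 * X 1 ^ 2 * X 2, 2 * X 0 ^ 2 * X 1 * X 2, X 0 ^ 2, X 1 ^ 2]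
  refine le_trans ?_ (ringKrullDim_quotient_anti (homogeneousIdeal_dualVariety_le_ker
    isHomogeneous_whitneyCubic ![X 0, X 1, -X 1 ^ 2 * X 2, X 0 ^ 2 * X 2] y ?_ ?_ (k := 2) ?_))
  · refine succ_le_ringKrullDim_quotient_ker _
      (aeval ![X 0, X 1, 0] : MvPolynomial (Fin 3) ℂ →ₐ[ℂ] MvPolynomial (Fin 3) ℂ).toRingHom
      (X 0) ?_ ?_ (n := 2) ?_
    · apply ne_zero_of_eval 1
      simp [y]
    · simp [y]
    refine succ_le_ringKrullDim_quotient_ker _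
      (aeval ![X 0, 0, 0] : MvPolynomial (Fin 3) ℂ →ₐ[ℂ] MvPolynomial (Fin 3) ℂ).toRingHom
      (X 3) ?_ ?_ (n := 1) ?_
    · apply ne_zero_of_eval 1
      simp [y]
    · simp [y]
    refine succ_le_ringKrullDim_quotient_ker _
      (aeval ![0, 0, 0] : MvPolynomial (Fin 3) ℂ →ₐ[ℂ] MvPolynomial (Fin 3) ℂ).toRingHom
      (X 2) ?_ ?_ (n := 0) (zero_le_ringKrullDim_quotient_ker _)
    · apply ne_zero_of_eval 1
      simp [y]
    · simp [y]
  · intro t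
    simp [whitneyCubic]
    ring
  · intro t i
    rw [grad_whitneyCubic]
    fin_cases i <;> simp [y] <;> ring
  · apply ne_zero_of_eval 1
    simp [y]

lemma dualDefect_cayleyCubic_nonpos (k : ℂ) : dualDefect (cayleyCubic k) ≤ 0 := by
  apply dualDefect_nonpos
  -- parametrisation by `(x₀, x₁, x₂, x₃) = (a b, a, t, -(k a b³ + b t))`
  let y : Fin 4 → MvPolynomial (Fin 3) ℂ :=
    ![C (3 * k) * X 0 ^ 2 * X 1 ^ 2 + X 0 * X 2,
      -X 0 * X 1 * X 2 - C (2 * k) * X 0 ^ 2 * X 1 ^ 3, X 0 ^ 2 * X 1, X 0 ^ 2]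
  refine le_trans ?_ (ringKrullDim_quotient_anti (homogeneousIdeal_dualVariety_le_ker
    (isHomogeneous_cayleyCubic k)
    ![X 0 * X 1, X 0, X 2, -(C k * X 0 * X 1 ^ 3 + X 1 * X 2)] y ?_ ?_ (k := 3) ?_))
  · refine succ_le_ringKrullDim_quotient_ker _
      (aeval ![X 0, X 1, 0] : MvPolynomial (Fin 3) ℂ →ₐ[ℂ] MvPolynomial (Fin 3) ℂ).toRingHom
      (X 0 * X 3 - C (3 * k) * X 2 ^ 2) ?_ ?_ (n := 2) ?_
    · apply ne_zero_of_eval 1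
      simp [y]
    · simp [y]
      ring
    refine succ_le_ringKrullDim_quotient_ker _
      (aeval ![X 0, 0, 0] : MvPolynomial (Fin 3) ℂ →ₐ[ℂ] MvPolynomial (Fin 3) ℂ).toRingHom
      (X 2) ?_ ?_ (n := 1) ?_
    · apply ne_zero_of_eval 1
      simp [y]
    · simp [y]
    refine succ_le_ringKrullDim_quotient_ker _
      (aeval ![0, 0, 0] : MvPolynomial (Fin 3) ℂ →ₐ[ℂ] MvPolynomial (Fin 3) ℂ).toRingHom
      (X 3) ?_ ?_ (n := 0) (zero_le_ringKrullDim_quotient_ker _)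
    · apply ne_zero_of_eval 1
      simp [y]
    · simp [y]
  · intro t
    simp [cayleyCubic]
    ring
  · intro t i
    rw [grad_cayleyCubic]
    fin_cases i <;> simp [y] <;> ring
  · apply ne_zero_of_eval 1
    simp [y]

lemma three_le_ringKrullDim_dualVariety_perazzoCubic :
    ((3 : ℕ) : WithBot ℕ∞) ≤
      ringKrullDim (CoordRing 4 ⧸ homogeneousIdeal (dualVariety perazzoCubic)) := by
  -- parametrisation by `(x₀, x₁, x₂, x₃, x₄) = (a, b, -a t, 0, b t)`
  let y : Fin 5 → MvPolynomial (Fin 3) ℂ :=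
    ![X 0 * X 1 * X 2, -X 0 ^ 2 * X 2, X 0 * X 1, X 1 ^ 2, X 0 ^ 2]
  refine le_trans ?_ (ringKrullDim_quotient_anti (homogeneousIdeal_dualVariety_le_ker
    isHomogeneous_perazzoCubic ![X 0, X 1, -X 0 * X 2, 0, X 1 * X 2] y ?_ ?_ (k := 4) ?_))
  · refine succ_le_ringKrullDim_quotient_ker _
      (aeval ![X 0, X 1, 0] : MvPolynomial (Fin 3) ℂ →ₐ[ℂ] MvPolynomial (Fin 3) ℂ).toRingHom
      (X 0) ?_ ?_ (n := 2) ?_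
    · apply ne_zero_of_eval 1
      simp [y]
    · simp [y]
    refine succ_le_ringKrullDim_quotient_ker _
      (aeval ![X 0, 0, 0] : MvPolynomial (Fin 3) ℂ →ₐ[ℂ] MvPolynomial (Fin 3) ℂ).toRingHom
      (X 3) ?_ ?_ (n := 1) ?_
    · apply ne_zero_of_eval 1
      simp [y]
    · simp [y]
    refine succ_le_ringKrullDim_quotient_ker _
      (aeval ![0, 0, 0] : MvPolynomial (Fin 3) ℂ →ₐ[ℂ] MvPolynomial (Fin 3) ℂ).toRingHom
      (X 4) ?_ ?_ (n := 0) (zero_le_ringKrullDim_quotient_ker _)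
    · apply ne_zero_of_eval 1
      simp [y]
    · simp [y]
  · intro t
    simp [perazzoCubic]
    ring
  · intro t i
    rw [grad_perazzoCubic]
    fin_cases i <;> simp [y] <;> ring
  · apply ne_zero_of_eval 1
    simp [y]

/-- A chain of two primes strictly below those containing `I` lowers the dimension by two. -/
lemma ringKrullDim_quotient_le_of_lt {R : Type*} [CommRing R] {I : Ideal R} {n : ℕ}
    (hR : ringKrullDim R = ((n + 2 : ℕ) : WithBot ℕ∞)) {Q₀ Q₁ Q₂ : Ideal R} (h₀ : Q₀.IsPrime)
    (h₁ : Q₁.IsPrime) (h01 : Q₀ < Q₁) (h12 : Q₁ < Q₂) (h : Q₂ ≤ I) :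
    ringKrullDim (R ⧸ I) ≤ n := by
  rw [ringKrullDim_quotient, Order.krullDim]
  refine iSup_le fun l' => ?_
  let l : LTSeries (PrimeSpectrum R) := ⟨l'.length, fun i => (l' i).1, fun i => l'.step i⟩
  have hl : I ≤ l.head.asIdeal := (l' 0).2
  let l₁ := RelSeries.cons l ⟨Q₁, h₁⟩ (show Q₁ < l.head.asIdeal from h12.trans_le (h.trans hl))
  let l₀ := RelSeries.cons l₁ ⟨Q₀, h₀⟩ (by rw [RelSeries.head_cons]; exact h01)
  have h4 := length_le_ringKrullDim l₀
  have h3 : l₀.length = l'.length + 2 := by simp [l₀, l₁, l]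
  rw [hR, h3] at h4
  have h5 : l'.length + 2 ≤ n + 2 := by exact_mod_cast h4
  have h6 : l'.length ≤ n := by omega
  exact_mod_cast h6

/-- The gradient `y` of the Perazzo cubic satisfies `y₂² = y₃ y₄` and, on the cubic,
`x₀ y₀ + x₁ y₁ = 0`; so the dual variety lies on the rational normal scroll parametrised by
`(b s, -a s, a b, b², a²)`, and has codimension at least two. -/
lemma ringKrullDim_dualVariety_perazzoCubic_le :
    ringKrullDim (CoordRing 4 ⧸ homogeneousIdeal (dualVariety perazzoCubic)) ≤ (3 : ℕ) := by
  let φ : CoordRing 4 →ₐ[ℂ] MvPolynomial (Fin 3) ℂ :=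
    aeval ![X 1 * X 2, -X 0 * X 2, X 0 * X 1, X 1 ^ 2, X 0 ^ 2]
  let ψ : CoordRing 4 →ₐ[ℂ] MvPolynomial (Fin 4) ℂ :=
    aeval ![X 2, X 3, X 0 * X 1, X 1 ^ 2, X 0 ^ 2]
  let σ : MvPolynomial (Fin 4) ℂ →ₐ[ℂ] MvPolynomial (Fin 3) ℂ :=
    aeval ![X 0, X 1, X 1 * X 2, -X 0 * X 2]
  have hσ : σ.comp ψ = φ := by
    apply MvPolynomial.algHom_ext
    intro i
    fin_cases i <;> simp [σ, φ, ψ]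
  have hlt : RingHom.ker ψ.toRingHom < RingHom.ker φ.toRingHom := by
    refine lt_of_le_of_ne (fun f hf => ?_) fun heq => ?_
    · rw [RingHom.mem_ker] at hf ⊢
      change φ f = 0
      rw [← hσ, AlgHom.comp_apply, show ψ f = 0 from hf, map_zero]
    · have h1 : X 4 * X 0 + X 2 * X 1 ∈ RingHom.ker φ.toRingHom := by
        rw [RingHom.mem_ker]
        simp [φ]
        ring
      rw [← heq, RingHom.mem_ker] at h1
      refine ne_zero_of_eval 1 ?_ h1
      simp [ψ]
  refine ringKrullDim_quotient_le_of_lt (n := 3) (ringKrullDim_mvPolynomial_fin 5)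
    (Q₀ := ⊥) (Q₁ := RingHom.ker ψ.toRingHom) (Q₂ := RingHom.ker φ.toRingHom)
    Ideal.isPrime_bot (RingHom.ker_isPrime _) ?_ hlt ?_
  · rw [bot_lt_iff_ne_bot]
    intro h
    have h1 : X 2 ^ 2 - X 3 * X 4 ∈ RingHom.ker ψ.toRingHom := by
      rw [RingHom.mem_ker]
      simp [ψ]
      ring
    rw [h, Ideal.mem_bot] at h1
    exact ne_zero_of_eval ![0, 0, 1, 0, 0] (by simp) h1
  · intro g hg
    rw [mem_homogeneousIdeal_dualVariety isHomogeneous_perazzoCubic]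
    intro v hv hgv
    rw [RingHom.mem_ker] at hg
    have hgt : ∀ t : Fin 3 → ℂ,
        eval ![t 1 * t 2, -t 0 * t 2, t 0 * t 1, t 1 ^ 2, t 0 ^ 2] g = 0 := by
      intro t
      have : (aeval t : _ →ₐ[ℂ] ℂ).comp φ =
          aeval ![t 1 * t 2, -t 0 * t 2, t 0 * t 1, t 1 ^ 2, t 0 ^ 2] := by
        apply MvPolynomial.algHom_ext
        intro i
        fin_cases i <;> simp [φ]
      have h2 := congrArg (fun χ : _ →ₐ[ℂ] ℂ => χ g) this
      rw [AlgHom.comp_apply, show φ g = 0 from hg, map_zero] at h2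
      exact h2.symm
    have hrel : v 0 * (v 1 * v 2 + 2 * v 0 * v 4) + v 1 * (v 0 * v 2 + 2 * v 1 * v 3) = 0 := by
      have : eval v perazzoCubic = v 0 * v 1 * v 2 + v 0 ^ 2 * v 4 + v 1 ^ 2 * v 3 := by
        simp [perazzoCubic]
      rw [hv] at this
      linear_combination -2 * this
    have hs : ∃ s, v 1 * v 2 + 2 * v 0 * v 4 = v 1 * s ∧ v 0 * v 2 + 2 * v 1 * v 3 = -v 0 * s := by
      by_cases h0 : v 0 = 0
      · by_cases h1 : v 1 = 0
        · exact absurd (by rw [grad_perazzoCubic]; simp [h0, h1]) hgv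
        · refine ⟨v 2, by rw [h0]; ring, ?_⟩
          simp only [h0, zero_mul, zero_add, neg_zero, mul_eq_zero, h1, false_or] at hrel ⊢
          simpa [h1] using hrel
      · refine ⟨-(v 0 * v 2 + 2 * v 1 * v 3) / v 0, ?_, ?_⟩
        · field_simp
          linear_combination hrel
        · field_simp
    obtain ⟨s, hs₀, hs₁⟩ := hs
    rw [grad_perazzoCubic, hs₀, hs₁]
    simpa using hgt ![v 0, v 1, s]

lemma dualDefect_perazzoCubic : dualDefect perazzoCubic = 1 := by
  have h1 := le_projDim three_le_ringKrullDim_dualVariety_perazzoCubic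
  have h2 := projDim_le ringKrullDim_dualVariety_perazzoCubic_le
  rw [dualDefect]
  push_cast at h1 h2 ⊢
  omega

/-! ### Frames of a linear subspace of codimension two -/

/-- The vectors `e₀`, `e₁` represent a basis of the quotient by the subspace `W`. -/
structure IsFrame {V : Type*} [AddCommGroup V] [Module ℂ V] (W : Submodule ℂ V) (e₀ e₁ : V) :
    Prop where
  indep : ∀ a b : ℂ, a • e₀ + b • e₁ ∈ W → a = 0 ∧ b = 0
  span : ∀ v, ∃ a b : ℂ, ∃ w ∈ W, v = a • e₀ + b • e₁ + w

section Frame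

variable {V : Type*} [AddCommGroup V] [Module ℂ V] {W : Submodule ℂ V} {e₀ e₁ : V}

lemma exists_isFrame [FiniteDimensional ℂ V]
    (h : Module.finrank ℂ W + 2 = Module.finrank ℂ V) : ∃ e₀ e₁ : V, IsFrame W e₀ e₁ := by
  obtain ⟨U, hU⟩ := W.exists_isCompl
  have hfin : Module.finrank ℂ U = 2 := by
    have := Submodule.finrank_add_eq_of_isCompl hU
    omega
  let b := Module.finBasisOfFinrankEq ℂ U hfin
  refine ⟨b 0, b 1, fun x y hxy => ?_, fun v => ?_⟩
  · have h1 : x • (b 0 : V) + y • (b 1 : V) = 0 :=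
      Submodule.disjoint_def.1 hU.disjoint _ hxy
        (U.add_mem (U.smul_mem _ (b 0).2) (U.smul_mem _ (b 1).2))
    have h2 : x • b 0 + y • b 1 = 0 := Subtype.ext h1
    have h3 := Fintype.linearIndependent_iff.1 b.linearIndependent ![x, y] (by
      simpa [Fin.sum_univ_two] using h2)
    exact ⟨h3 0, h3 1⟩
  · obtain ⟨w, hw, u, hu, rfl⟩ := Submodule.mem_sup.1
      (hU.sup_eq_top ▸ Submodule.mem_top : v ∈ W ⊔ U)
    refine ⟨b.repr ⟨u, hu⟩ 0, b.repr ⟨u, hu⟩ 1, w, hw, ?_⟩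
    have h1 := congrArg Subtype.val (b.sum_repr ⟨u, hu⟩)
    rw [Fin.sum_univ_two] at h1
    rw [add_comm w]
    congr 1
    exact h1.symm

lemma IsFrame.change (h : IsFrame W e₀ e₁) {p q r s : ℂ} (hdet : p * s - q * r ≠ 0) :
    IsFrame W (p • e₀ + q • e₁) (r • e₀ + s • e₁) := by
  refine ⟨fun a b hab => ?_, fun v => ?_⟩
  · have h1 := h.indep (a * p + b * r) (a * q + b * s) (by
      convert hab using 1
      module)
    constructor
    · refine (mul_eq_zero.1 (?_ : a * (p * s - q * r) = 0)).resolve_right hdet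
      linear_combination s * h1.1 - r * h1.2
    · refine (mul_eq_zero.1 (?_ : b * (p * s - q * r) = 0)).resolve_right hdet
      linear_combination p * h1.2 - q * h1.1
  · obtain ⟨a, b, w, hw, rfl⟩ := h.span v
    refine ⟨(a * s - b * r) / (p * s - q * r), (b * p - a * q) / (p * s - q * r), w, hw, ?_⟩
    congr 1
    have h1 : a = (a * s - b * r) / (p * s - q * r) * p +
        (b * p - a * q) / (p * s - q * r) * r := by
      rw [div_mul_eq_mul_div, div_mul_eq_mul_div, ← add_div, eq_div_iff hdet]
      ring
    have h2 : b = (a * s - b * r) / (p * s - q * r) * q +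
        (b * p - a * q) / (p * s - q * r) * s := by
      rw [div_mul_eq_mul_div, div_mul_eq_mul_div, ← add_div, eq_div_iff hdet]
      ring
    conv_lhs => rw [h1, h2]
    module

/-- A nonzero combination of the vectors of a frame is part of a frame. -/
lemma IsFrame.exists_left (h : IsFrame W e₀ e₁) {p q : ℂ} (hpq : p ≠ 0 ∨ q ≠ 0) :
    ∃ e, IsFrame W (p • e₀ + q • e₁) e := by
  rcases hpq with hp | hq
  · exact ⟨_, h.change (r := 0) (s := 1) (by simpa using hp)⟩
  · exact ⟨_, h.change (r := 1) (s := 0) (by simpa using hq)⟩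

end Frame

/-- Homogeneous coordinates adapted to a frame. -/
lemma IsFrame.exists_coord {n : ℕ} {W : Submodule ℂ (Fin n → ℂ)} {e₀ e₁ : Fin n → ℂ}
    (h : IsFrame W e₀ e₁) (i j : Fin n) (g : (Fin n → ℂ) →ₗ[ℂ] (Fin n → ℂ)) (hg : ∀ x, g x ∈ W)
    (hinj : ∀ x, x i = 0 → x j = 0 → g x = 0 → x = 0) :
    ∃ e : (Fin n → ℂ) ≃ₗ[ℂ] (Fin n → ℂ), ∀ x, e x = x i • e₀ + x j • e₁ + g x := by
  let L : (Fin n → ℂ) →ₗ[ℂ] (Fin n → ℂ) :=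
    (LinearMap.proj i).smulRight e₀ + (LinearMap.proj j).smulRight e₁ + g
  have hL : ∀ x, L x = x i • e₀ + x j • e₁ + g x := fun x => rfl
  refine ⟨LinearEquiv.ofInjectiveEndo L ?_, hL⟩
  rw [← LinearMap.ker_eq_bot, LinearMap.ker_eq_bot']
  intro x hx
  rw [hL] at hx
  have h1 := h.indep (x i) (x j) (by
    rw [eq_neg_of_add_eq_zero_left hx]
    exact W.neg_mem (hg x))
  refine hinj x h1.1 h1.2 ?_
  simpa [h1.1, h1.2] using hx

/-! ### A cubic singular along a linear subspace of codimension two -/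

section SingularAlong

variable {N : ℕ} {F : CoordRing N}
  {T : (Fin (N + 1) → ℂ) →ₗ[ℂ] (Fin (N + 1) → ℂ) →ₗ[ℂ] (Fin (N + 1) → ℂ) →ₗ[ℂ] ℂ}
  {W : Submodule ℂ (Fin (N + 1) → ℂ)} {e₀ e₁ : Fin (N + 1) → ℂ}

lemma IsPolarForm.apply_eq_zero_of_mem (hT : IsPolarForm F T) (hW : ∀ w ∈ W, T w w = 0)
    {w w' : Fin (N + 1) → ℂ} (hw : w ∈ W) (hw' : w' ∈ W) (x : Fin (N + 1) → ℂ) :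
    T w w' x = 0 := by
  have h := congrArg (fun f => f x) (hW _ (W.add_mem hw hw'))
  simp only [map_add, LinearMap.add_apply, hW w hw, hW w' hw', LinearMap.zero_apply,
    hT.swap₁₂ w' w] at h
  linear_combination h / 2

/-- The expansion of a cubic form in coordinates adapted to a linear space of singular points. -/
lemma IsPolarForm.eval_frame (hT : IsPolarForm F T) (hW : ∀ w ∈ W, T w w = 0)
    (e₀ e₁ : Fin (N + 1) → ℂ) {w : Fin (N + 1) → ℂ} (hw : w ∈ W) (a b : ℂ) :
    eval (a • e₀ + b • e₁ + w) F =
      a ^ 3 * T e₀ e₀ e₀ + 3 * a ^ 2 * b * T e₀ e₀ e₁ + 3 * a * b ^ 2 * T e₀ e₁ e₁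
        + b ^ 3 * T e₁ e₁ e₁
        + 3 * a ^ 2 * T e₀ e₀ w + 6 * a * b * T e₀ e₁ w + 3 * b ^ 2 * T e₁ e₁ w := by
  have z1 : ∀ x, T w w x = 0 := fun x => by rw [hW w hw]; rfl
  have z2 : ∀ x, T w x w = 0 := fun x => by rw [hT.swap₂₃, z1]
  have z3 : ∀ x, T x w w = 0 := fun x => by rw [hT.swap₁₂, z2]
  have s1 : ∀ x, T x w x = T x x w := fun x => hT.swap₂₃ _ _ _
  have s2 : ∀ x, T w x x = T x x w := fun x => by rw [hT.swap₁₂, s1]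
  have s3 : T e₀ e₁ e₀ = T e₀ e₀ e₁ := hT.swap₂₃ _ _ _
  have s4 : T e₁ e₀ e₀ = T e₀ e₀ e₁ := by rw [hT.swap₁₂, s3]
  have s5 : T e₁ e₀ e₁ = T e₀ e₁ e₁ := hT.swap₁₂ _ _ _
  have s6 : T e₁ e₁ e₀ = T e₀ e₁ e₁ := by rw [hT.swap₂₃, s5]
  have s7 : T e₁ e₀ w = T e₀ e₁ w := hT.swap₁₂ _ _ _
  have s8 : T e₀ w e₁ = T e₀ e₁ w := hT.swap₂₃ _ _ _
  have s9 : T e₁ w e₀ = T e₀ e₁ w := by rw [hT.swap₂₃, s7]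
  have s10 : T w e₀ e₁ = T e₀ e₁ w := by rw [hT.swap₁₂, s8]
  have s11 : T w e₁ e₀ = T e₀ e₁ w := by rw [hT.swap₁₂, s9]
  rw [hT.eval_eq]
  simp only [map_add, map_smul, LinearMap.add_apply, LinearMap.smul_apply, smul_eq_mul,
    z1, z2, z3, s1, s2, s3, s4, s5, s6, s7, s8, s9, s10, s11]
  ring

/-- If the cubic is not a cone, then a vector of `W` is determined by its pairings with the
quadratic monomials in the frame. -/
lemma IsPolarForm.eq_zero_of_frame (hF : F.IsHomogeneous 3) (hcone : ¬ IsCone (zeroSet F))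
    (hT : IsPolarForm F T) (hW : ∀ w ∈ W, T w w = 0) (h : IsFrame W e₀ e₁)
    {w : Fin (N + 1) → ℂ} (hw : w ∈ W) (h₀₀ : T e₀ e₀ w = 0) (h₀₁ : T e₀ e₁ w = 0)
    (h₁₁ : T e₁ e₁ w = 0) : w = 0 := by
  by_contra hne
  refine hcone (hT.isCone hF hne (LinearMap.ext fun x => LinearMap.ext fun y => ?_))
  obtain ⟨a, b, u, hu, rfl⟩ := h.span x
  obtain ⟨c, d, v, hv, rfl⟩ := h.span y
  have z1 : ∀ x, T w u x = 0 := fun x => hT.apply_eq_zero_of_mem hW hw hu x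
  have z2 : ∀ x, T w x v = 0 := fun x => by
    rw [hT.swap₂₃]; exact hT.apply_eq_zero_of_mem hW hw hv x
  have s : ∀ x y, T w x y = T x y w := fun x y => by rw [hT.swap₁₂, hT.swap₂₃]
  have s7 : T e₁ e₀ w = T e₀ e₁ w := hT.swap₁₂ _ _ _
  simp only [map_add, map_smul, LinearMap.add_apply, LinearMap.smul_apply, smul_eq_mul,
    z1, z2, s e₀ e₀, s e₀ e₁, s e₁ e₀, s e₁ e₁, s7, h₀₀, h₀₁, h₁₁]
  simp

/-- The pairings of the vectors of `W` with the quadratic monomials in the frame. -/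
noncomputable def pairing
    (T : (Fin (N + 1) → ℂ) →ₗ[ℂ] (Fin (N + 1) → ℂ) →ₗ[ℂ] (Fin (N + 1) → ℂ) →ₗ[ℂ] ℂ)
    (W : Submodule ℂ (Fin (N + 1) → ℂ)) (e₀ e₁ : Fin (N + 1) → ℂ) : W →ₗ[ℂ] (Fin 3 → ℂ) :=
  (LinearMap.pi ![T e₀ e₀, T e₀ e₁, T e₁ e₁]).comp W.subtype

lemma IsPolarForm.pairing_injective (hF : F.IsHomogeneous 3) (hcone : ¬ IsCone (zeroSet F))
    (hT : IsPolarForm F T) (hW : ∀ w ∈ W, T w w = 0) (h : IsFrame W e₀ e₁) :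
    Function.Injective (pairing T W e₀ e₁) := by
  rw [← LinearMap.ker_eq_bot, LinearMap.ker_eq_bot']
  intro w hw
  exact Subtype.ext (hT.eq_zero_of_frame hF hcone hW h w.2 (congrFun hw 0) (congrFun hw 1)
    (congrFun hw 2))

end SingularAlong

/-- A binary quadratic form over `ℂ` is a product of linear forms. -/
lemma exists_factor_binary_quadratic (α β γ : ℂ) :
    ∃ l₀ l₁ m₀ m₁ : ℂ, l₀ * m₀ = α ∧ l₀ * m₁ + l₁ * m₀ = β ∧ l₁ * m₁ = γ := by
  by_cases hα : α = 0
  · exact ⟨0, 1, β, γ, by simp [hα], by ring, by ring⟩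
  · obtain ⟨s, hs⟩ := IsAlgClosed.exists_eq_mul_self (discrim α (-β) γ)
    obtain ⟨r, hr⟩ := exists_quadratic_eq_zero (b := -β) (c := γ) hα ⟨s, hs⟩
    exact ⟨1, r, α, β - r * α, by ring, by ring, by linear_combination -hr⟩

/-- An irreducible cubic form does not vanish on a hyperplane. -/
lemma false_of_vanishing_on_hyperplane {N : ℕ} {G : CoordRing N} (hG : G.IsHomogeneous 3)
    (hirr : Irreducible G) (j : Fin (N + 1)) (h : ∀ x : Fin (N + 1) → ℂ, x j = 0 → eval x G = 0) :
    False := by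
  classical
  have h0 : aeval (Function.update X j 0 : Fin (N + 1) → CoordRing N) G = 0 := by
    apply MvPolynomial.funext
    intro x
    have h1 : (aeval x : _ →ₐ[ℂ] ℂ).comp (aeval (Function.update X j 0)) =
        aeval (Function.update x j 0) := by
      apply MvPolynomial.algHom_ext
      intro i
      by_cases hij : i = j
      · subst hij; simp
      · simp [hij]
    have h2 := congrArg (fun φ : _ →ₐ[ℂ] ℂ => φ G) h1
    rw [map_zero]
    refine h2.trans (h _ ?_)
    simp
  -- modulo `X j` the substitution `X j ↦ 0` changes nothing
  have h3 : (Ideal.Quotient.mkₐ ℂ (Ideal.span {(X j : CoordRing N)})).comp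
      (aeval (Function.update X j 0)) =
        Ideal.Quotient.mkₐ ℂ (Ideal.span {(X j : CoordRing N)}) := by
    apply MvPolynomial.algHom_ext
    intro i
    by_cases hij : i = j
    · subst hij
      simp only [AlgHom.comp_apply, aeval_X, Function.update_self, map_zero]
      exact (Ideal.Quotient.eq_zero_iff_mem.2 (Ideal.mem_span_singleton_self _)).symm
    · simp [hij]
  have h4 := congrArg (fun φ : CoordRing N →ₐ[ℂ] _ => φ G) h3
  rw [AlgHom.comp_apply, h0, map_zero] at h4
  have h5 : G ∈ Ideal.span {(X j : CoordRing N)} := Ideal.Quotient.eq_zero_iff_mem.1 h4.symm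
  obtain ⟨q, hq⟩ := Ideal.mem_span_singleton.1 h5
  have hdeg := hG.totalDegree hirr.ne_zero
  have hq0 : q ≠ 0 := by
    rintro rfl
    exact hirr.ne_zero (by rw [hq, mul_zero])
  rw [hq, totalDegree_mul_of_isDomain (X_ne_zero j) hq0, totalDegree_X] at hdeg
  rcases hirr.isUnit_or_isUnit hq with hu | hu
  · have := hu.map (eval (0 : Fin (N + 1) → ℂ))
    simp at this
  · obtain ⟨r, hr⟩ := hu.exists_right_inv
    have hr0 : r ≠ 0 := by
      rintro rfl
      simp at hr
    have := totalDegree_mul_of_isDomain hq0 hr0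
    rw [hr, totalDegree_one] at this
    omega

/-! ### Normal forms -/

/-- A cubic in `ℙ¹` has a root, so it is not irreducible. -/
lemma false_of_dim_one {F : CoordRing 1} (hF : F.IsHomogeneous 3) (hirr : Irreducible F)
    {T} (hT : IsPolarForm F T) {W : Submodule ℂ (Fin 2 → ℂ)} (hW : ∀ w ∈ W, T w w = 0)
    (hfin : Module.finrank ℂ W + 1 = 1) : False := by
  obtain ⟨e₀, e₁, h⟩ := exists_isFrame (W := W) (by rw [Module.finrank_fin_fun]; omega)
  have hbot : W = ⊥ := Submodule.finrank_eq_zero.1 (by omega)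
  -- a root of the binary form
  obtain ⟨p, q, hpq, hroot⟩ : ∃ p q : ℂ, (p ≠ 0 ∨ q ≠ 0) ∧ eval (p • e₀ + q • e₁) F = 0 := by
    by_cases h1 : T e₁ e₁ e₁ = 0
    · exact ⟨0, 1, Or.inr one_ne_zero, by simpa [hT.eval_eq] using h1⟩
    · obtain ⟨t, ht⟩ := IsAlgClosed.exists_root
        (Polynomial.C (T e₁ e₁ e₁) * Polynomial.X ^ 3 +
          Polynomial.C (3 * T e₀ e₁ e₁) * Polynomial.X ^ 2 +
          Polynomial.C (3 * T e₀ e₀ e₁) * Polynomial.X + Polynomial.C (T e₀ e₀ e₀))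
        (by rw [Polynomial.degree_cubic h1]; decide)
      refine ⟨1, t, Or.inl one_ne_zero, ?_⟩
      have h2 := hT.eval_frame hW e₀ e₁ W.zero_mem 1 t
      simp only [Polynomial.IsRoot, Polynomial.eval_add, Polynomial.eval_mul, Polynomial.eval_C,
        Polynomial.eval_pow, Polynomial.eval_X] at ht
      rw [add_zero] at h2
      rw [h2]
      simp only [map_zero]
      linear_combination ht
  obtain ⟨e, he⟩ := h.exists_left hpq
  obtain ⟨c, hc⟩ := he.exists_coord 0 1 0 (fun x => by simp) (fun x h0 h1 _ => by
    ext i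
    fin_cases i
    · exact h0
    · exact h1)
  refine false_of_vanishing_on_hyperplane
    (isHomogeneous_of_eval_eq (eval_linSubstEquiv c · F) hF)
    (irreducible_of_eval_eq (eval_linSubstEquiv c · F) hirr) 1 fun x hx => ?_
  rw [eval_linSubstEquiv, hc, hx]
  simp only [zero_smul, add_zero, LinearMap.zero_apply]
  rw [eval_smul_of_isHomogeneous hF, hroot, mul_zero]

/-- A plane cubic which is singular, irreducible and not a cone has a node or a cusp, according as
the quadratic form `T · · w` on the quotient by `W = ℂ w` has rank two or one. -/
lemma dualDefect_nonpos_of_dim_two {F : CoordRing 2} (hF : F.IsHomogeneous 3)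
    (hirr : Irreducible F) (hcone : ¬ IsCone (zeroSet F)) {T} (hT : IsPolarForm F T)
    {W : Submodule ℂ (Fin 3 → ℂ)} (hW : ∀ w ∈ W, T w w = 0)
    (hfin : Module.finrank ℂ W + 1 = 2) : dualDefect F ≤ 0 := by
  obtain ⟨f₀, f₁, hf⟩ := exists_isFrame (W := W) (by rw [Module.finrank_fin_fun]; omega)
  obtain ⟨⟨w, hw⟩, hw0, hspan⟩ := finrank_eq_one_iff'.1 (show Module.finrank ℂ W = 1 by omega)
  have hw0 : w ≠ 0 := fun h => hw0 (Subtype.ext h)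
  -- an isotropic vector of the quadratic form `T · · w` on the quotient by `W`
  obtain ⟨p, q, hpq, hroot⟩ : ∃ p q : ℂ, (p ≠ 0 ∨ q ≠ 0) ∧
      T (p • f₀ + q • f₁) (p • f₀ + q • f₁) w = 0 := by
    by_cases h1 : T f₀ f₀ w = 0
    · exact ⟨1, 0, Or.inl one_ne_zero, by simpa using h1⟩
    · obtain ⟨s, hs⟩ :=
        IsAlgClosed.exists_eq_mul_self (discrim (T f₀ f₀ w) (2 * T f₀ f₁ w) (T f₁ f₁ w))
      obtain ⟨t, ht⟩ := exists_quadratic_eq_zero h1 ⟨s, hs⟩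
      refine ⟨t, 1, Or.inr one_ne_zero, ?_⟩
      simp only [map_add, map_smul, LinearMap.add_apply, LinearMap.smul_apply, smul_eq_mul,
        one_smul, hT.swap₁₂ f₁ f₀]
      linear_combination ht
  obtain ⟨e₁, he⟩ := hf.exists_left hpq
  set e₀ := p • f₀ + q • f₁
  -- coordinates in which `W` is spanned by the last basis vector
  have hcoord : ∀ {e₀ e₁ : Fin 3 → ℂ}, IsFrame W e₀ e₁ → ∀ u₀ u₁ u₂ : ℂ, u₂ ≠ 0 →
      ∃ c : (Fin 3 → ℂ) ≃ₗ[ℂ] (Fin 3 → ℂ), ∀ x, c x =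
        x 0 • e₀ + x 1 • e₁ + (x 0 * u₀ + x 1 * u₁ + x 2 * u₂) • w := by
    intro e₀ e₁ h u₀ u₁ u₂ hu
    refine h.exists_coord 0 1
      ((u₀ • LinearMap.proj 0 + u₁ • LinearMap.proj 1 + u₂ • LinearMap.proj 2 :
        (Fin 3 → ℂ) →ₗ[ℂ] ℂ).smulRight w) (fun x => W.smul_mem _ hw) (fun x h0 h1 h2 => ?_) |>.imp
      fun c hc x => ?_
    · have h3 : x 2 = 0 := by simpa [h0, h1, hw0, hu] using h2
      ext i
      fin_cases i
      · exact h0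
      · exact h1
      · exact h3
    · rw [hc]
      simp [mul_comm]
  have h000 : T e₀ e₀ e₀ ≠ 0 := by
    intro h0
    obtain ⟨c, hc⟩ := hcoord he 0 0 1 one_ne_zero
    refine false_of_vanishing_on_hyperplane
      (isHomogeneous_of_eval_eq (eval_linSubstEquiv c · F) hF)
      (irreducible_of_eval_eq (eval_linSubstEquiv c · F) hirr) 1 fun x hx => ?_
    rw [eval_linSubstEquiv, hc, hT.eval_frame hW _ _ (W.smul_mem _ hw), hx]
    simp [h0, hroot]
  by_cases h01 : T e₀ e₁ w = 0
  · have h11 : T e₁ e₁ w ≠ 0 := fun h11 =>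
      hw0 (hT.eq_zero_of_frame hF hcone hW he hw hroot h01 h11)
    -- replace `e₁` to remove the coefficient of `x₀² x₁`
    set r := -T e₀ e₀ e₁ / T e₀ e₀ e₀ with hr
    have he' : IsFrame W e₀ (r • e₀ + e₁) := by
      have := he.change (p := 1) (q := 0) (r := r) (s := 1) (by simp)
      simpa using this
    have k001 : T e₀ e₀ (r • e₀ + e₁) = 0 := by
      simp only [map_add, map_smul, smul_eq_mul, hr]
      field_simp
      ring
    have k01 : T e₀ (r • e₀ + e₁) w = 0 := by simp [hroot, h01]
    have k11 : T (r • e₀ + e₁) (r • e₀ + e₁) w = T e₁ e₁ w := by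
      simp [hroot, h01, hT.swap₁₂ e₁ e₀]
    set e₁' := r • e₀ + e₁
    rw [← k11] at h11
    obtain ⟨c, hc⟩ := hcoord he' (-T e₀ e₁' e₁' / T e₁' e₁' w)
      (-T e₁' e₁' e₁' / (3 * T e₁' e₁' w)) (1 / (3 * T e₁' e₁' w)) (by simp [h11])
    have hG : ∀ x, eval x (cuspCubic (T e₀ e₀ e₀)) = eval (c x) F := by
      intro x
      rw [hc, hT.eval_frame hW _ _ (W.smul_mem _ hw)]
      simp only [map_smul, smul_eq_mul, hroot, k01, k001, cuspCubic, map_add, map_mul, map_pow,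
        eval_C, eval_X]
      field_simp
      ring
    rw [← dualDefect_of_eval_eq hF hG]
    exact dualDefect_cuspCubic_nonpos h000
  · -- replace `e₁` by the second isotropic vector
    set r := -T e₁ e₁ w / (2 * T e₀ e₁ w) with hr
    have he' : IsFrame W e₀ (r • e₀ + e₁) := by
      have := he.change (p := 1) (q := 0) (r := r) (s := 1) (by simp)
      simpa using this
    have k01 : T e₀ (r • e₀ + e₁) w = T e₀ e₁ w := by simp [hroot]
    have k11 : T (r • e₀ + e₁) (r • e₀ + e₁) w = 0 := by
      simp only [map_add, map_smul, LinearMap.add_apply, LinearMap.smul_apply, smul_eq_mul,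
        hroot, hT.swap₁₂ e₁ e₀, hr]
      field_simp
      ring
    set e₁' := r • e₀ + e₁
    rw [← k01] at h01
    obtain ⟨c, hc⟩ := hcoord he' (-T e₀ e₀ e₁' / (2 * T e₀ e₁' w))
      (-T e₀ e₁' e₁' / (2 * T e₀ e₁' w)) (1 / (6 * T e₀ e₁' w)) (by simp [h01])
    have hG : ∀ x, eval x (nodeCubic (T e₀ e₀ e₀) (T e₁' e₁' e₁')) = eval (c x) F := by
      intro x
      rw [hc, hT.eval_frame hW _ _ (W.smul_mem _ hw)]
      simp only [map_smul, smul_eq_mul, hroot, k11, nodeCubic, map_add, map_mul, map_pow,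
        eval_C, eval_X]
      field_simp
      ring
    rw [← dualDefect_of_eval_eq hF hG]
    exact dualDefect_nodeCubic_nonpos h000 _

/-- The quadratic forms `T · · w`, for `w ∈ W`, satisfy a linear relation `T l m w = 0`; the normal
form depends on whether `l` and `m` are independent. -/
lemma dualDefect_nonpos_of_dim_three {F : CoordRing 3} (hF : F.IsHomogeneous 3)
    (hcone : ¬ IsCone (zeroSet F)) {T} (hT : IsPolarForm F T)
    {W : Submodule ℂ (Fin 4 → ℂ)} (hW : ∀ w ∈ W, T w w = 0)
    (hfin : Module.finrank ℂ W + 1 = 3) : dualDefect F ≤ 0 := by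
  obtain ⟨f₀, f₁, hf⟩ := exists_isFrame (W := W) (by rw [Module.finrank_fin_fun]; omega)
  -- a linear relation between the quadratic forms `T · · w`, in factored form
  obtain ⟨l₀, l₁, m₀, m₁, hl, hm, hlm⟩ : ∃ l₀ l₁ m₀ m₁ : ℂ, (l₀ ≠ 0 ∨ l₁ ≠ 0) ∧
      (m₀ ≠ 0 ∨ m₁ ≠ 0) ∧ ∀ w ∈ W, T (l₀ • f₀ + l₁ • f₁) (m₀ • f₀ + m₁ • f₁) w = 0 := by
    have hlt : LinearMap.range (pairing T W f₀ f₁) < ⊤ := by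
      rw [lt_top_iff_ne_top]
      intro htop
      have h1 := LinearMap.finrank_range_le (pairing T W f₀ f₁)
      rw [htop, finrank_top] at h1
      simp at h1
      omega
    obtain ⟨φ, hφ0, hφ⟩ := Submodule.exists_le_ker_of_lt_top _ hlt
    obtain ⟨l₀, l₁, m₀, m₁, h0, h1, h2⟩ := exists_factor_binary_quadratic
      (φ (Pi.single 0 1)) (φ (Pi.single 1 1)) (φ (Pi.single 2 1))
    have hφv : ∀ v, φ v = v 0 * (l₀ * m₀) + v 1 * (l₀ * m₁ + l₁ * m₀) + v 2 * (l₁ * m₁) := by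
      intro v
      have : v = v 0 • Pi.single 0 1 + v 1 • Pi.single 1 1 + v 2 • Pi.single 2 1 := by
        ext i
        fin_cases i <;> simp
      rw [h0, h1, h2]
      conv_lhs => rw [this]
      simp only [map_add, map_smul, smul_eq_mul]
    refine ⟨l₀, l₁, m₀, m₁, ?_, ?_, fun w hw => ?_⟩
    · by_contra! hc
      exact hφ0 (LinearMap.ext fun v => by rw [hφv, hc.1, hc.2]; simp)
    · by_contra! hc
      exact hφ0 (LinearMap.ext fun v => by rw [hφv, hc.1, hc.2]; simp)
    · have h3 : φ (pairing T W f₀ f₁ ⟨w, hw⟩) = 0 := hφ ⟨_, rfl⟩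
      rw [hφv] at h3
      have h4 : pairing T W f₀ f₁ ⟨w, hw⟩ 0 = T f₀ f₀ w := rfl
      have h5 : pairing T W f₀ f₁ ⟨w, hw⟩ 1 = T f₀ f₁ w := rfl
      have h6 : pairing T W f₀ f₁ ⟨w, hw⟩ 2 = T f₁ f₁ w := rfl
      rw [h4, h5, h6] at h3
      simp only [map_add, map_smul, LinearMap.add_apply, LinearMap.smul_apply, smul_eq_mul,
        hT.swap₁₂ f₁ f₀]
      linear_combination h3
  have hcoord : ∀ {e₀ e₁ : Fin 4 → ℂ}, IsFrame W e₀ e₁ → ∀ u₀ u₁ u₂ u₃ : W,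
      LinearIndependent ℂ ![u₂, u₃] →
      ∃ c : (Fin 4 → ℂ) ≃ₗ[ℂ] (Fin 4 → ℂ), ∀ x, c x =
        x 0 • e₀ + x 1 • e₁ + ((x 0 • u₀ + x 1 • u₁ + x 2 • u₂ + x 3 • u₃ : W) : Fin 4 → ℂ) := by
    intro e₀ e₁ h u₀ u₁ u₂ u₃ hu
    refine h.exists_coord 0 1
      (W.subtype.comp (Fintype.linearCombination ℂ ![u₀, u₁, u₂, u₃]))
      (fun x => Subtype.coe_prop _) (fun x h0 h1 h2 => ?_) |>.imp fun c hc x => ?_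
    · have h3 : x 2 • u₂ + x 3 • u₃ = 0 := by
        have := Subtype.ext (a1 := Fintype.linearCombination ℂ ![u₀, u₁, u₂, u₃] x) (a2 := 0) h2
        simpa [Fintype.linearCombination_apply, Fin.sum_univ_succ, h0, h1] using this
      have h4 := LinearIndependent.pair_iff.1 hu _ _ h3
      ext i
      fin_cases i
      · exact h0
      · exact h1
      · exact h4.1
      · exact h4.2
    · rw [hc]
      simp [Fintype.linearCombination_apply, Fin.sum_univ_succ, add_assoc]
  by_cases hdet : l₀ * m₁ - l₁ * m₀ = 0
  · -- the two factors are proportional: all the quadratic forms have a common root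
    obtain ⟨e₁, he⟩ := hf.exists_left hl
    set e₀ := l₀ • f₀ + l₁ • f₁ with he₀
    have h00 : ∀ w ∈ W, T e₀ e₀ w = 0 := by
      intro w hw
      rcases hm with hm | hm
      · have h1 : m₀ • e₀ = l₀ • (m₀ • f₀ + m₁ • f₁) := by
          rw [he₀, smul_add, smul_add, smul_smul, smul_smul, smul_smul, smul_smul,
            sub_eq_zero.1 hdet, mul_comm m₀ l₀, mul_comm m₀ l₁]
        have h2 : m₀ * T e₀ e₀ w = 0 := by
          have : T e₀ (m₀ • e₀) w = 0 := by
            rw [h1]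
            simp only [map_smul, LinearMap.smul_apply, hlm w hw, smul_zero]
          simpa using this
        exact (mul_eq_zero.1 h2).resolve_left hm
      · have h1 : m₁ • e₀ = l₁ • (m₀ • f₀ + m₁ • f₁) := by
          rw [he₀, smul_add, smul_add, smul_smul, smul_smul, smul_smul, smul_smul,
            ← sub_eq_zero.1 hdet, mul_comm m₁ l₀, mul_comm m₁ l₁]
        have h2 : m₁ * T e₀ e₀ w = 0 := by
          have : T e₀ (m₁ • e₀) w = 0 := by
            rw [h1]
            simp only [map_smul, LinearMap.smul_apply, hlm w hw, smul_zero]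
          simpa using this
        exact (mul_eq_zero.1 h2).resolve_left hm
    let Λ : W →ₗ[ℂ] (Fin 2 → ℂ) := (LinearMap.pi ![T e₀ e₁, T e₁ e₁]).comp W.subtype
    have hΛ : Function.Injective Λ := by
      rw [← LinearMap.ker_eq_bot, LinearMap.ker_eq_bot']
      intro w hw
      exact Subtype.ext (hT.eq_zero_of_frame hF hcone hW he w.2 (h00 _ w.2) (congrFun hw 0)
        (congrFun hw 1))
    have hsurj : ∀ a b : ℂ, ∃ w : W, T e₀ e₁ w = a ∧ T e₁ e₁ w = b := by
      intro a b
      obtain ⟨w, hw⟩ := (LinearMap.injective_iff_surjective_of_finrank_eq_finrank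
        (by simp; omega)).1 hΛ ![a, b]
      exact ⟨w, congrFun hw 0, congrFun hw 1⟩
    obtain ⟨u₀, a₀, b₀⟩ := hsurj (-T e₀ e₀ e₁ / 2) (-T e₀ e₁ e₁)
    obtain ⟨u₁, a₁, b₁⟩ := hsurj 0 (-T e₁ e₁ e₁ / 3)
    obtain ⟨u₂, a₂, b₂⟩ := hsurj (1 / 6) 0
    obtain ⟨u₃, a₃, b₃⟩ := hsurj 0 (1 / 3)
    obtain ⟨c, hc⟩ := hcoord he u₀ u₁ u₂ u₃ (by
      rw [LinearIndependent.pair_iff]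
      intro s t hst
      have h1 := congrArg (fun w : W => T e₀ e₁ w) hst
      have h2 := congrArg (fun w : W => T e₁ e₁ w) hst
      simp [a₂, a₃, b₂, b₃] at h1 h2
      exact ⟨h1, h2⟩)
    have hG : ∀ x, eval x (cayleyCubic (T e₀ e₀ e₀)) = eval (c x) F := by
      intro x
      rw [hc, hT.eval_frame hW _ _ (Subtype.coe_prop _), h00 _ (Subtype.coe_prop _)]
      simp only [Submodule.coe_add, Submodule.coe_smul, map_add, map_smul, smul_eq_mul,
        a₀, a₁, a₂, a₃, b₀, b₁, b₂, b₃, cayleyCubic, map_mul, map_pow, eval_C, eval_X]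
      ring
    rw [← dualDefect_of_eval_eq hF hG]
    exact dualDefect_cayleyCubic_nonpos _
  · have he := hf.change hdet
    set e₀ := l₀ • f₀ + l₁ • f₁
    set e₁ := m₀ • f₀ + m₁ • f₁
    let Λ : W →ₗ[ℂ] (Fin 2 → ℂ) := (LinearMap.pi ![T e₀ e₀, T e₁ e₁]).comp W.subtype
    have hΛ : Function.Injective Λ := by
      rw [← LinearMap.ker_eq_bot, LinearMap.ker_eq_bot']
      intro w hw
      exact Subtype.ext (hT.eq_zero_of_frame hF hcone hW he w.2 (congrFun hw 0) (hlm _ w.2)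
        (congrFun hw 1))
    have hsurj : ∀ a b : ℂ, ∃ w : W, T e₀ e₀ w = a ∧ T e₁ e₁ w = b := by
      intro a b
      obtain ⟨w, hw⟩ := (LinearMap.injective_iff_surjective_of_finrank_eq_finrank
        (by simp; omega)).1 hΛ ![a, b]
      exact ⟨w, congrFun hw 0, congrFun hw 1⟩
    obtain ⟨u₀, a₀, b₀⟩ := hsurj (-T e₀ e₀ e₀ / 3) (-T e₀ e₁ e₁)
    obtain ⟨u₁, a₁, b₁⟩ := hsurj (-T e₀ e₀ e₁) (-T e₁ e₁ e₁ / 3)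
    obtain ⟨u₂, a₂, b₂⟩ := hsurj (1 / 3) 0
    obtain ⟨u₃, a₃, b₃⟩ := hsurj 0 (1 / 3)
    obtain ⟨c, hc⟩ := hcoord he u₀ u₁ u₂ u₃ (by
      rw [LinearIndependent.pair_iff]
      intro s t hst
      have h1 := congrArg (fun w : W => T e₀ e₀ w) hst
      have h2 := congrArg (fun w : W => T e₁ e₁ w) hst
      simp [a₂, a₃, b₂, b₃] at h1 h2
      exact ⟨h1, h2⟩)
    have hG : ∀ x, eval x whitneyCubic = eval (c x) F := by
      intro x
      rw [hc, hT.eval_frame hW _ _ (Subtype.coe_prop _), hlm _ (Subtype.coe_prop _)]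
      simp only [Submodule.coe_add, Submodule.coe_smul, map_add, map_smul, smul_eq_mul,
        a₀, a₁, a₂, a₃, b₀, b₁, b₂, b₃, whitneyCubic, map_mul, map_pow, eval_X]
      ring
    rw [← dualDefect_of_eval_eq hF hG]
    exact dualDefect_whitneyCubic_nonpos

/-- The quadratic forms `T · · w`, for `w ∈ W`, are all the binary quadratic forms, which determines
the cubic. -/
lemma perazzo_of_dim_four {F : CoordRing 4} (hF : F.IsHomogeneous 3)
    (hcone : ¬ IsCone (zeroSet F)) {T} (hT : IsPolarForm F T)
    {W : Submodule ℂ (Fin 5 → ℂ)} (hW : ∀ w ∈ W, T w w = 0)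
    (hfin : Module.finrank ℂ W + 1 = 4) :
    dualDefect F = 1 ∧ ProjEquivalent (zeroSet F) (zeroSet perazzoCubic) ∧
      IsPlane 2 (singularLocus F) := by
  obtain ⟨e₀, e₁, he⟩ := exists_isFrame (W := W) (by rw [Module.finrank_fin_fun]; omega)
  have hsurj : ∀ p q r : ℂ, ∃ w : W, T e₀ e₀ w = p ∧ T e₀ e₁ w = q ∧ T e₁ e₁ w = r := by
    intro p q r
    obtain ⟨w, hw⟩ := (LinearMap.injective_iff_surjective_of_finrank_eq_finrank
      (by simp; omega)).1 (hT.pairing_injective hF hcone hW he) ![p, q, r]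
    exact ⟨w, congrFun hw 0, congrFun hw 1, congrFun hw 2⟩
  obtain ⟨u₀, p₀, q₀, r₀⟩ := hsurj (-T e₀ e₀ e₀ / 3) (-T e₀ e₀ e₁ / 2) 0
  obtain ⟨u₁, p₁, q₁, r₁⟩ := hsurj 0 (-T e₀ e₁ e₁ / 2) (-T e₁ e₁ e₁ / 3)
  obtain ⟨u₂, p₂, q₂, r₂⟩ := hsurj 0 (1 / 6) 0
  obtain ⟨u₃, p₃, q₃, r₃⟩ := hsurj 0 0 (1 / 3)
  obtain ⟨u₄, p₄, q₄, r₄⟩ := hsurj (1 / 3) 0 0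
  obtain ⟨c, hc⟩ := he.exists_coord 0 1
    (W.subtype.comp (Fintype.linearCombination ℂ ![u₀, u₁, u₂, u₃, u₄]))
    (fun x => Subtype.coe_prop _) (fun x h0 h1 h2 => by
      have h3 : (x 2 • u₂ + (x 3 • u₃ + x 4 • u₄) : Fin 5 → ℂ) = 0 := by
        simpa [Fintype.linearCombination_apply, Fin.sum_univ_succ, h0, h1] using h2
      have k0 := congrArg (T e₀ e₀) h3
      have k1 := congrArg (T e₀ e₁) h3
      have k2 := congrArg (T e₁ e₁) h3
      simp [p₂, p₃, p₄, q₂, q₃, q₄, r₂, r₃, r₄] at k0 k1 k2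
      ext i
      fin_cases i
      · exact h0
      · exact h1
      · exact k1
      · exact k2
      · exact k0)
  have hG : ∀ x, eval x perazzoCubic = eval (c x) F := by
    intro x
    have hmem : (W.subtype.comp (Fintype.linearCombination ℂ ![u₀, u₁, u₂, u₃, u₄])) x ∈ W :=
      Subtype.coe_prop _
    rw [hc, hT.eval_frame hW _ _ hmem]
    simp [Fintype.linearCombination_apply, Fin.sum_univ_succ, p₀, p₁, p₂, p₃, p₄, q₀, q₁, q₂, q₃,
      q₄, r₀, r₁, r₂, r₃, r₄, perazzoCubic]
    ring
  refine ⟨?_, projEquivalent_of_eval_eq hF hG, W, Nat.add_right_cancel (m := 1) hfin, ?_⟩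
  · rw [← dualDefect_of_eval_eq hF hG, dualDefect_perazzoCubic]
  · ext p
    induction p using Projectivization.ind with
    | h v hv =>
      rw [hT.mk_mem_singularLocus hF]
      have hmem : Projectivization.mk ℂ v hv ∈ linearVariety W ↔ v ∈ W := by
        change (Projectivization.mk ℂ v hv).submodule ≤ W ↔ _
        rw [Projectivization.submodule_mk, Submodule.span_singleton_le_iff_mem]
      rw [hmem]
      refine ⟨fun h => ?_, hW v⟩
      obtain ⟨a, b, w, hw, rfl⟩ := he.span v
      have key : ∀ u ∈ W, a ^ 2 * T e₀ e₀ u + 2 * a * b * T e₀ e₁ u + b ^ 2 * T e₁ e₁ u = 0 := by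
        intro u hu
        have h1 := congrArg (fun f => f u) h
        have z1 : ∀ x, T w x u = 0 := fun x => by
          rw [hT.swap₂₃]; exact hT.apply_eq_zero_of_mem hW hw hu x
        have z2 : ∀ x, T x w u = 0 := fun x => by rw [hT.swap₁₂, z1]
        simp only [map_add, map_smul, LinearMap.add_apply, LinearMap.smul_apply, smul_eq_mul,
          z1, z2, hT.swap₁₂ e₁ e₀, LinearMap.zero_apply] at h1
        linear_combination h1
      have ha := key u₄ u₄.2
      have hb := key u₃ u₃.2
      simp [p₃, p₄, q₃, q₄, r₃, r₄] at ha hb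
      simpa [ha, hb] using hw

end ProjGeom

theorem mainTheorem2 (N : ℕ) (F : ProjGeom.CoordRing N)
    (hF_hom : F.IsHomogeneous 3) (hF_irr : Irreducible F)
    (hF_cone : ¬ ProjGeom.IsCone (ProjGeom.zeroSet F))
    (hF_sing : ProjGeom.projDim (ProjGeom.singularLocus F) = (N : ℤ) - 2) :
    (0 < ProjGeom.dualDefect F ↔
      (N = 4 ∧ ProjGeom.dualDefect F = 1 ∧
        ProjGeom.ProjEquivalent (ProjGeom.zeroSet F)
          (ProjGeom.zeroSet ProjGeom.perazzoCubic))) ∧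
    (0 < ProjGeom.dualDefect F → ProjGeom.IsPlane 2 (ProjGeom.singularLocus F)) := by
  obtain ⟨T, hT⟩ := ProjGeom.exists_isPolarForm hF_hom
  obtain ⟨W, hfin, hW⟩ :=
    ProjGeom.exists_linear_singular_subspace hF_hom hF_irr hF_cone hT hF_sing
  suffices h : 0 < ProjGeom.dualDefect F → N = 4 ∧ ProjGeom.dualDefect F = 1 ∧
      ProjGeom.ProjEquivalent (ProjGeom.zeroSet F) (ProjGeom.zeroSet ProjGeom.perazzoCubic) ∧
      ProjGeom.IsPlane 2 (ProjGeom.singularLocus F) from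
    ⟨⟨fun hpos => ⟨(h hpos).1, (h hpos).2.1, (h hpos).2.2.1⟩,
      fun h1 => by rw [h1.2.1]; exact one_pos⟩, fun hpos => (h hpos).2.2.2⟩
  intro hpos
  have hN : N ≤ 4 := by
    obtain ⟨e₀, e₁, he⟩ := ProjGeom.exists_isFrame (W := W) (by rw [Module.finrank_fin_fun]; omega)
    have := LinearMap.finrank_le_finrank_of_injective
      (hT.pairing_injective hF_hom hF_cone hW he)
    simp at this
    omega
  interval_cases N
  · omega
  · exact (ProjGeom.false_of_dim_one hF_hom hF_irr hT hW hfin).elim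
  · exact absurd
      (ProjGeom.dualDefect_nonpos_of_dim_two hF_hom hF_irr hF_cone hT hW hfin) (not_le.2 hpos)
  · exact absurd
      (ProjGeom.dualDefect_nonpos_of_dim_three hF_hom hF_cone hT hW hfin) (not_le.2 hpos)
  · exact ⟨rfl, ProjGeom.perazzo_of_dim_four hF_hom hF_cone hT hW hfin⟩
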